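/- Let $q\in\mathbb{C}$ be a primitive $n$-th root of unity with $n\ge 3$, $n\neq 4$, and let $d=n$ if $n$ is odd, $d=n/2$ if $n$ is even. Let $\mathrm{u}_q=\mathrm{u}_q(\mathfrak{sl}_2(\mathbb{C}))$ be the algebra with generators $E,F,K$ and relations $E^d=F^d=0$, $K^d=1$, $KE=q^2EK$, $KF=q^{-2}FK$, $EF-FE=\frac{K-K^{-1}}{q-q^{-1}}$, with comultiplication $\Delta(E)=1\otimes E+E\otimes K$, $\Delta(F)=K^{-1}\otimes F+F\otimes 1$, $\Delta(K)=K\otimes K$, and let $\mathrm{u}_q^+$ be the subalgebra generated by $E$ and $K$, with the restricted comultiplication. Put $$R=\frac1d\sum_{0\le i,j,k\le d-1}\frac{(q-q^{-1})^k}{[k]!}\,q^{k(k-1)/2+2k(i-j)-2ij}\,E^kK^i\otimes F^kK^j\in \mathrm{u}_q\otimes\mathrm{u}_q ,$$ where $[m]=\frac{q^m-q^{-m}}{q-q^{-1}}$ and $[k]!=[1][2]\cdots[k]$, and let $\tau$ be the flip. All modules are finite dimensional left modules, and tensor products are over $\mathbb{C}$ with the action through $\Delta$. A $\mathrm{u}_q^+$-module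 is *extendable* if its action of $\mathrm{u}_q^+$ is the restriction of an action of $\mathrm{u}_q$ on the same space. The *orbit* of the extendable indecomposables is the class of all $\mathrm{u}_q^+$-modules isomorphic to $S\otimes X$ with $S$ a simple and $X$ an extendable indecomposable $\mathrm{u}_q^+$-module. For $i\in\mathbb{Z}/d\mathbb{Z}$ and $0\le u\le d-1$, $M_i^u$ is the $\mathrm{u}_q^+$-module with basis $e_0,\dots,e_u$, $Ke_j=q^{2(i+j)}e_j$, $Ee_j=e_{j+1}$ for $j<u$, $Ee_u=0$. For $\mathrm{u}_q^+$-modules $M,N$ in the orbit, an isomorphism $f:M\otimes N\to N\otimes M$ of $\mathrm{u}_q^+$-modules is said to be *given by the $R$-matrix* if there are simple $\mathrm{u}_q^+$-modules $S,T$, $\mathrm{u}_q$-modules $X,Y$ that are indecomposable over $\mathrm{u}_q^+$, and isomorphisms of $\mathrm{u}_q^+$-modules $M\cong S\otimes X$, $N\cong T\otimes Y$, $X\otimes T\cong T\otimes X$, $Y\otimes S\cong S\otimes Y$, such that, under the induced identifications $$M\otimes N\cong S\otimes X\otimes T\otimes Y\cong (S\otimes T)\otimes(X\otimes Y),\qquad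 N\otimes M\cong T\otimes Y\otimes S\otimes X\cong (T\otimes S)\otimes(Y\otimes X),$$ $f$ is the tensor product of the flip $S\otimes T\to T\otimes S$ and the action of $\tau R$, $X\otimes Y\to Y\otimes X$. 1. Suppose $d$ is odd. Then the orbit of the extendable indecomposables is the class of all indecomposable $\mathrm{u}_q^+$-modules. Hence for all indecomposable $\mathrm{u}_q^+$-modules $M,N$ there is an isomorphism $M\otimes N\cong N\otimes M$ given by the $R$-matrix; and for arbitrary $\mathrm{u}_q^+$-modules $M,N$ there are decompositions $M\cong\bigoplus_i P_i$, $N\cong\bigoplus_j Q_j$ into indecomposables and an isomorphism $M\otimes N\cong N\otimes M$ which is the direct sum of isomorphisms $P_i\otimes Q_j\cong Q_j\otimes P_i$ given by the $R$-matrix. 2. Suppose $d$ is even. Then the orbit contains every indecomposable $\mathrm{u}_q^+$-module of odd dimension. Hence for all indecomposable $\mathrm{u}_q^+$-modules $M,N$ of odd dimension there is an isomorphism $M\otimes N\cong N\otimes M$ given by the $R$-matrix; in particular, for all $i,j$ and all even $u,v$, there is one between $M_i^u\otimes M_j^v$ and $M_j^v\otimes M_i^u$. -/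

import Mathlib

open scoped TensorProduct

universe u

namespace HalfQuantum

/-! ### A vanishing statement for `q`-binomial expansions -/

/-- Gaussian binomial coefficients at `z`, through the Pascal recursion. -/
def gaussCoeff (z : ℂ) : ℕ → ℕ → ℂ
  | 0, 0 => 1
  | 0, _ + 1 => 0
  | m + 1, 0 => gaussCoeff z m 0
  | m + 1, k + 1 => gaussCoeff z m k + z ^ (k + 1) * gaussCoeff z m (k + 1)

theorem gaussCoeff_zero_right (z : ℂ) (m : ℕ) : gaussCoeff z m 0 = 1 := by
  induction m with
  | zero => rfl
  | succ m ih => simpa [gaussCoeff] using ih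

theorem gaussCoeff_of_lt (z : ℂ) (m k : ℕ) (h : m < k) : gaussCoeff z m k = 0 := by
  induction m generalizing k with
  | zero => cases k with
    | zero => omega
    | succ k => rfl
  | succ m ih => cases k with
    | zero => omega
    | succ k => simp [gaussCoeff, ih k (by omega), ih (k + 1) (by omega)]

theorem gaussCoeff_self (z : ℂ) (m : ℕ) : gaussCoeff z m m = 1 := by
  induction m with
  | zero => rfl
  | succ m ih => simp [gaussCoeff, ih, gaussCoeff_of_lt z m (m + 1) (by omega)]

theorem gaussCoeff_absorb (z : ℂ) (m k : ℕ) :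
    gaussCoeff z (m + 1) (k + 1) * (1 - z ^ (k + 1)) = gaussCoeff z m k * (1 - z ^ (m + 1)) := by
  induction m generalizing k with
  | zero => cases k with
    | zero => simp [gaussCoeff]
    | succ k => simp [gaussCoeff]
  | succ m ih => cases k with
    | zero =>
      have h := ih 0
      have h3 : gaussCoeff z (m + 1 + 1) (0 + 1) =
        gaussCoeff z (m + 1) 0 + z ^ (0 + 1) * gaussCoeff z (m + 1) (0 + 1) := rfl
      rw [gaussCoeff_zero_right] at h h3 ⊢
      linear_combination z * h + (1 - z) * h3
    | succ k =>
      have h1 := ih k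
      have h2 := ih (k + 1)
      rw [gaussCoeff]
      have h3 : gaussCoeff z (m + 1) (k + 1) =
        gaussCoeff z m k + z ^ (k + 1) * gaussCoeff z m (k + 1) := rfl
      linear_combination z * h1 + z ^ (k + 1 + 1) * h2 - z * (1 - z ^ (m + 1)) * h3

theorem gaussCoeff_eq_zero {z : ℂ} {d k : ℕ} (hz : IsPrimitiveRoot z d) (h0 : 0 < k)
    (hk : k < d) : gaussCoeff z d k = 0 := by
  obtain ⟨k, rfl⟩ : ∃ j, k = j + 1 := ⟨k - 1, by omega⟩
  obtain ⟨d, rfl⟩ : ∃ j, d = j + 1 := ⟨d - 1, by omega⟩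
  have h := gaussCoeff_absorb z d k
  rw [hz.pow_eq_one, sub_self, mul_zero] at h
  refine (mul_eq_zero.mp h).resolve_right fun h' => ?_
  exact hz.pow_ne_one_of_pos_of_lt (by omega) hk (sub_eq_zero.mp h').symm

theorem mul_pow_qcomm {B : Type*} [Ring B] [Algebra ℂ B] {z : ℂ} {x y : B}
    (h : y * x = z • (x * y)) (k : ℕ) : y * x ^ k = z ^ k • (x ^ k * y) := by
  induction k with
  | zero => simp
  | succ k ih =>
    rw [pow_succ, ← mul_assoc, ih, smul_mul_assoc, mul_assoc, h, mul_smul_comm, smul_smul,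
      mul_assoc, pow_succ]

theorem add_pow_qcomm {B : Type*} [Ring B] [Algebra ℂ B] {z : ℂ} {x y : B}
    (h : y * x = z • (x * y)) (m : ℕ) :
    (x + y) ^ m = ∑ k ∈ Finset.range (m + 1), gaussCoeff z m k • (x ^ k * y ^ (m - k)) := by
  induction m with
  | zero => simp [gaussCoeff]
  | succ m ih =>
    have hx : x * (x + y) ^ m =
        ∑ k ∈ Finset.range (m + 1), gaussCoeff z m k • (x ^ (k + 1) * y ^ (m - k)) := by
      rw [ih, Finset.mul_sum]
      refine Finset.sum_congr rfl fun k _ => ?_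
      rw [mul_smul_comm, ← mul_assoc, pow_succ']
    have hy : y * (x + y) ^ m = ∑ k ∈ Finset.range (m + 1),
        (z ^ k * gaussCoeff z m k) • (x ^ k * y ^ (m + 1 - k)) := by
      rw [ih, Finset.mul_sum]
      refine Finset.sum_congr rfl fun k hk => ?_
      have hk' : m + 1 - k = (m - k) + 1 := by
        have := Finset.mem_range.mp hk; omega
      rw [mul_smul_comm, ← mul_assoc, mul_pow_qcomm h, smul_mul_assoc, smul_smul, mul_assoc, hk',
        pow_succ' y, mul_comm]
    have hy2 : y * (x + y) ^ m = y ^ (m + 1) + ∑ k ∈ Finset.range (m + 1),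
        (z ^ (k + 1) * gaussCoeff z m (k + 1)) • (x ^ (k + 1) * y ^ (m - k)) := by
      rw [hy, Finset.sum_range_succ' _ m, Finset.sum_range_succ _ m,
        gaussCoeff_of_lt z m (m + 1) (by omega), gaussCoeff_zero_right]
      simp [add_comm]
    rw [pow_succ', add_mul, hx, hy2, Finset.sum_range_succ' _ (m + 1), gaussCoeff_zero_right,
      add_comm (y ^ (m + 1)), ← add_assoc, ← Finset.sum_add_distrib]
    simp only [gaussCoeff, add_smul, pow_zero, one_mul, one_smul, Nat.sub_zero,
      Nat.add_sub_add_right]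

/-- If `y x = z x y` with `z` a primitive `d`-th root of unity then `(x + y)^d = x^d + y^d`. -/
theorem add_pow_of_qcomm {B : Type*} [Ring B] [Algebra ℂ B] {z : ℂ} {d : ℕ} (hd : 0 < d)
    (hz : IsPrimitiveRoot z d) {x y : B} (h : y * x = z • (x * y)) :
    (x + y) ^ d = x ^ d + y ^ d := by
  rw [add_pow_qcomm h, Finset.sum_range_succ, gaussCoeff_self]
  obtain ⟨d, rfl⟩ : ∃ j, d = j + 1 := ⟨d - 1, by omega⟩
  rw [Finset.sum_range_succ', gaussCoeff_zero_right, Finset.sum_eq_zero]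
  · simp [add_comm]
  · intro k hk
    rw [gaussCoeff_eq_zero hz (by omega) (by have := Finset.mem_range.mp hk; omega), zero_smul]

/-! ### The root of unity -/

/-- The standing data: a primitive `n`-th root of unity `q` in `ℂ` with `n ≠ 4`. The condition
`3 ≤ n` says that `q - q⁻¹ ≠ 0`, without which the relations below make no sense. -/
structure RootDatum where
  n : ℕ
  q : ℂ
  prim : IsPrimitiveRoot q n
  three_le : 3 ≤ n
  ne_four : n ≠ 4

namespace RootDatum

variable (D : RootDatum)

/-- `d = n` for `n` odd and `d = n / 2` for `n` even. -/
def d : ℕ := if Odd D.n then D.n else D.n / 2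

theorem d_pos : 0 < D.d := by
  have := D.three_le
  unfold d; split_ifs <;> omega

theorem sq_prim : IsPrimitiveRoot (D.q ^ 2) D.d := by
  have h3 := D.three_le
  unfold d
  split_ifs with h
  · exact D.prim.pow_of_coprime 2 (Nat.coprime_two_left.mpr h)
  · have h2 : Even D.n := Nat.not_odd_iff_even.mp h
    exact D.prim.pow (by omega) (by obtain ⟨r, hr⟩ := h2; omega)

theorem q_ne_zero : D.q ≠ 0 := D.prim.ne_zero (by have := D.three_le; omega)

end RootDatum

/-! ### The algebra `u_q(sl₂)` -/

/-- The three generators of `u_q(sl₂)`. -/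
inductive Gen
  | E | F | K

/-- The defining relations of `u_q(sl₂)`. Since `K ^ d = 1`, the inverse of `K` is
`K ^ (d - 1)`. -/
inductive Rel (D : RootDatum) : FreeAlgebra ℂ Gen → FreeAlgebra ℂ Gen → Prop
  | E_pow : Rel D (FreeAlgebra.ι ℂ Gen.E ^ D.d) 0
  | F_pow : Rel D (FreeAlgebra.ι ℂ Gen.F ^ D.d) 0
  | K_pow : Rel D (FreeAlgebra.ι ℂ Gen.K ^ D.d) 1
  | K_E : Rel D (FreeAlgebra.ι ℂ Gen.K * FreeAlgebra.ι ℂ Gen.E)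
      (D.q ^ 2 • (FreeAlgebra.ι ℂ Gen.E * FreeAlgebra.ι ℂ Gen.K))
  | K_F : Rel D (FreeAlgebra.ι ℂ Gen.K * FreeAlgebra.ι ℂ Gen.F)
      ((D.q ^ 2)⁻¹ • (FreeAlgebra.ι ℂ Gen.F * FreeAlgebra.ι ℂ Gen.K))
  | E_F : Rel D (FreeAlgebra.ι ℂ Gen.E * FreeAlgebra.ι ℂ Gen.F
        - FreeAlgebra.ι ℂ Gen.F * FreeAlgebra.ι ℂ Gen.E)
      ((D.q - D.q⁻¹)⁻¹ • (FreeAlgebra.ι ℂ Gen.K - FreeAlgebra.ι ℂ Gen.K ^ (D.d - 1)))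

/-- The algebra `u_q(sl₂(ℂ))`, by generators and relations. -/
def Uq (D : RootDatum) : Type := RingQuot (Rel D)

namespace Uq

variable (D : RootDatum)

instance : Ring (Uq D) := inferInstanceAs (Ring (RingQuot (Rel D)))

instance : Algebra ℂ (Uq D) := inferInstanceAs (Algebra ℂ (RingQuot (Rel D)))

/-- The quotient map from the free algebra. -/
def mk : FreeAlgebra ℂ Gen →ₐ[ℂ] Uq D := RingQuot.mkAlgHom ℂ (Rel D)

theorem mk_rel {x y : FreeAlgebra ℂ Gen} (h : Rel D x y) : mk D x = mk D y :=
  RingQuot.mkAlgHom_rel ℂ h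

/-- The generator `E`. -/
def E : Uq D := mk D (FreeAlgebra.ι ℂ Gen.E)

/-- The generator `F`. -/
def F : Uq D := mk D (FreeAlgebra.ι ℂ Gen.F)

/-- The generator `K`. -/
def K : Uq D := mk D (FreeAlgebra.ι ℂ Gen.K)

/-- The element `K⁻¹`. -/
def Kinv : Uq D := K D ^ (D.d - 1)

theorem E_pow : E D ^ D.d = 0 := by simpa [E] using mk_rel D Rel.E_pow

theorem F_pow : F D ^ D.d = 0 := by simpa [F] using mk_rel D Rel.F_pow

theorem K_pow : K D ^ D.d = 1 := by simpa [K] using mk_rel D Rel.K_pow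

theorem K_E : K D * E D = D.q ^ 2 • (E D * K D) := by
  simpa only [K, E, map_mul, map_smul] using mk_rel D Rel.K_E

theorem K_F : K D * F D = (D.q ^ 2)⁻¹ • (F D * K D) := by
  simpa only [K, F, map_mul, map_smul] using mk_rel D Rel.K_F

theorem E_F : E D * F D - F D * E D = (D.q - D.q⁻¹)⁻¹ • (K D - Kinv D) := by
  simpa only [K, F, E, Kinv, map_mul, map_smul, map_sub, map_pow] using mk_rel D Rel.E_F

theorem Kinv_mul_K : Kinv D * K D = 1 := by
  rw [Kinv, ← pow_succ, Nat.sub_add_cancel D.d_pos, K_pow]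

theorem K_mul_Kinv : K D * Kinv D = 1 := by
  rw [Kinv, ← pow_succ', Nat.sub_add_cancel D.d_pos, K_pow]

theorem F_K : F D * K D = D.q ^ 2 • (K D * F D) := by
  rw [K_F, smul_smul, mul_inv_cancel₀ (pow_ne_zero 2 D.q_ne_zero), one_smul]

theorem E_Kinv : E D * Kinv D = D.q ^ 2 • (Kinv D * E D) := by
  calc E D * Kinv D = Kinv D * (K D * E D) * Kinv D := by
        rw [← mul_assoc, Kinv_mul_K, one_mul]
    _ = D.q ^ 2 • (Kinv D * E D) := by
        rw [K_E, mul_smul_comm, smul_mul_assoc, mul_assoc, mul_assoc, K_mul_Kinv, mul_one]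

theorem F_Kinv : F D * Kinv D = (D.q ^ 2)⁻¹ • (Kinv D * F D) := by
  calc F D * Kinv D = Kinv D * (K D * F D) * Kinv D := by
        rw [← mul_assoc, Kinv_mul_K, one_mul]
    _ = (D.q ^ 2)⁻¹ • (Kinv D * F D) := by
        rw [K_F, mul_smul_comm, smul_mul_assoc, mul_assoc, mul_assoc, K_mul_Kinv, mul_one]

/-! ### The comultiplication of `u_q(sl₂)` -/

/-- The comultiplication on generators: `Δ E = 1 ⊗ E + E ⊗ K`, `Δ F = K⁻¹ ⊗ F + F ⊗ 1`,
`Δ K = K ⊗ K`. -/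
def comulGen : Gen → Uq D ⊗[ℂ] Uq D
  | Gen.E => 1 ⊗ₜ[ℂ] E D + E D ⊗ₜ[ℂ] K D
  | Gen.F => Kinv D ⊗ₜ[ℂ] F D + F D ⊗ₜ[ℂ] 1
  | Gen.K => K D ⊗ₜ[ℂ] K D

theorem comulGen_rel ⦃x y : FreeAlgebra ℂ Gen⦄ (h : Rel D x y) :
    FreeAlgebra.lift ℂ (comulGen D) x = FreeAlgebra.lift ℂ (comulGen D) y := by
  have hd : D.d ≠ 0 := D.d_pos.ne'
  induction h with
  | E_pow =>
    simp only [map_pow, map_zero, FreeAlgebra.lift_ι_apply, comulGen]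
    rw [add_pow_of_qcomm D.d_pos D.sq_prim]
    · simp [Algebra.TensorProduct.tmul_pow, E_pow]
    · simp [Algebra.TensorProduct.tmul_mul_tmul, K_E, TensorProduct.tmul_smul]
  | F_pow =>
    simp only [map_pow, map_zero, FreeAlgebra.lift_ι_apply, comulGen]
    rw [add_pow_of_qcomm D.d_pos D.sq_prim.inv]
    · simp [Algebra.TensorProduct.tmul_pow, F_pow]
    · simp [Algebra.TensorProduct.tmul_mul_tmul, F_Kinv, TensorProduct.smul_tmul']
  | K_pow =>
    simp [comulGen, Algebra.TensorProduct.tmul_pow, K_pow, Algebra.TensorProduct.one_def]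
  | K_E =>
    simp [comulGen, Algebra.TensorProduct.tmul_mul_tmul, mul_add, add_mul, K_E,
      TensorProduct.tmul_smul, TensorProduct.smul_tmul']
  | K_F =>
    have h : K D * Kinv D = Kinv D * K D := by rw [K_mul_Kinv, Kinv_mul_K]
    simp [comulGen, Algebra.TensorProduct.tmul_mul_tmul, mul_add, add_mul, K_F, h,
      TensorProduct.tmul_smul, TensorProduct.smul_tmul']
  | E_F =>
    simp only [map_sub, map_mul, map_smul, map_pow, FreeAlgebra.lift_ι_apply, comulGen,
      Algebra.TensorProduct.tmul_mul_tmul, Algebra.TensorProduct.tmul_pow, mul_add, add_mul,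
      one_mul, mul_one, E_Kinv, F_K]
    have e1 : E D * F D = F D * E D + (D.q - D.q⁻¹)⁻¹ • (K D - Kinv D) := by
      rw [← E_F]; abel
    simp only [e1, ← Kinv.eq_1, TensorProduct.tmul_add, TensorProduct.add_tmul,
      TensorProduct.tmul_smul, ← TensorProduct.smul_tmul', TensorProduct.tmul_sub,
      TensorProduct.sub_tmul, smul_sub]
    abel

/-- The comultiplication `Δ` of `u_q(sl₂)`, an algebra homomorphism. -/
def comul : Uq D →ₐ[ℂ] Uq D ⊗[ℂ] Uq D :=
  RingQuot.liftAlgHom ℂ ⟨FreeAlgebra.lift ℂ (comulGen D), comulGen_rel D⟩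

theorem comul_mk (g : Gen) : comul D (mk D (FreeAlgebra.ι ℂ g)) = comulGen D g := by
  refine (RingQuot.liftAlgHom_mkAlgHom_apply ℂ _ (comulGen_rel D) _).trans ?_
  rw [FreeAlgebra.lift_ι_apply]

theorem comul_E : comul D (E D) = 1 ⊗ₜ[ℂ] E D + E D ⊗ₜ[ℂ] K D := comul_mk D Gen.E

theorem comul_F : comul D (F D) = Kinv D ⊗ₜ[ℂ] F D + F D ⊗ₜ[ℂ] 1 := comul_mk D Gen.F

theorem comul_K : comul D (K D) = K D ⊗ₜ[ℂ] K D := comul_mk D Gen.K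

/-! ### The `R`-matrix of `u_q(sl₂)` -/

/-- The quantum integer `[m] = (q ^ m - q ^ (-m)) / (q - q⁻¹)`. -/
noncomputable def qInt (m : ℕ) : ℂ := (D.q ^ m - D.q⁻¹ ^ m) / (D.q - D.q⁻¹)

/-- The quantum factorial `[k]! = [1] [2] ⋯ [k]`. -/
noncomputable def qFactorial (k : ℕ) : ℂ := ∏ m ∈ Finset.range k, qInt D (m + 1)

/-- The `R`-matrix
`R = (1/d) ∑_{0 ≤ i,j,k ≤ d-1} (q - q⁻¹)^k / [k]! q^{k(k-1)/2 + 2k(i-j) - 2ij} E^k K^i ⊗ F^k K^j`. -/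
noncomputable def rMatrix : Uq D ⊗[ℂ] Uq D :=
  (1 / (D.d : ℂ)) • ∑ i ∈ Finset.range D.d, ∑ j ∈ Finset.range D.d, ∑ k ∈ Finset.range D.d,
    ((D.q - D.q⁻¹) ^ k / qFactorial D k *
      D.q ^ (((k * (k - 1) / 2 : ℕ) : ℤ) + 2 * (k : ℤ) * ((i : ℤ) - (j : ℤ))
        - 2 * (i : ℤ) * (j : ℤ))) •
      ((E D ^ k * K D ^ i) ⊗ₜ[ℂ] (F D ^ k * K D ^ j))

end Uq

/-! ### The half-quantum group `u_q⁺` -/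

/-- `u_q⁺`, the subalgebra of `u_q(sl₂)` generated by `E` and `K`. -/
def UqPlus (D : RootDatum) : Subalgebra ℂ (Uq D) := Algebra.adjoin ℂ {Uq.E D, Uq.K D}

namespace UqPlus

variable (D : RootDatum)

/-- `E` as an element of `u_q⁺`. -/
def E : UqPlus D := ⟨Uq.E D, Algebra.subset_adjoin (by simp)⟩

/-- `K` as an element of `u_q⁺`. -/
def K : UqPlus D := ⟨Uq.K D, Algebra.subset_adjoin (by simp)⟩

/-- The map `u_q⁺ ⊗ u_q⁺ → u_q ⊗ u_q` induced by the inclusion. -/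
def tensorIncl : UqPlus D ⊗[ℂ] UqPlus D →ₐ[ℂ] Uq D ⊗[ℂ] Uq D :=
  Algebra.TensorProduct.map (UqPlus D).val (UqPlus D).val

theorem tensorIncl_injective : Function.Injective (tensorIncl D) :=
  Module.Flat.tensorProduct_mapIncl_injective_of_left
    (Subalgebra.toSubmodule (UqPlus D)) (Subalgebra.toSubmodule (UqPlus D))

/-- `Δ(u_q⁺) ⊆ u_q⁺ ⊗ u_q⁺`. -/
theorem comul_mem (x : UqPlus D) : Uq.comul D x ∈ (tensorIncl D).range := by
  have h : UqPlus D ≤ (tensorIncl D).range.comap (Uq.comul D) := by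
    refine Algebra.adjoin_le ?_
    rintro x (rfl | rfl)
    · refine ⟨1 ⊗ₜ[ℂ] E D + E D ⊗ₜ[ℂ] K D, ?_⟩
      simp [tensorIncl, Uq.comul_E, E, K]
    · refine ⟨K D ⊗ₜ[ℂ] K D, ?_⟩
      simp [tensorIncl, Uq.comul_K, K]
  exact h x.2

/-- The comultiplication of `u_q⁺`, the restriction of the one of `u_q(sl₂)`. -/
noncomputable def comul : UqPlus D →ₐ[ℂ] UqPlus D ⊗[ℂ] UqPlus D :=
  ((AlgEquiv.ofInjective (tensorIncl D) (tensorIncl_injective D)).symm : _ →ₐ[ℂ] _).comp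
    (((Uq.comul D).comp (UqPlus D).val).codRestrict (tensorIncl D).range (comul_mem D))

theorem tensorIncl_comul (x : UqPlus D) : tensorIncl D (comul D x) = Uq.comul D x := by
  have h := (AlgEquiv.ofInjective (tensorIncl D) (tensorIncl_injective D)).apply_symm_apply
    (((Uq.comul D).comp (UqPlus D).val).codRestrict (tensorIncl D).range (comul_mem D) x)
  exact congrArg Subtype.val h

end UqPlus

/-! ### Finite dimensional modules -/

/-- A finite dimensional left module over a complex algebra `A`: a finite dimensional complex
vector space with an algebra homomorphism from `A` to its endomorphisms. -/
structure FinMod (A : Type) [Ring A] [Algebra ℂ A] where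
  carrier : Type u
  [addCommGroup : AddCommGroup carrier]
  [module : Module ℂ carrier]
  [finite : FiniteDimensional ℂ carrier]
  act : A →ₐ[ℂ] Module.End ℂ carrier

namespace FinMod

attribute [instance] FinMod.addCommGroup FinMod.module FinMod.finite

section General

variable {A : Type} [Ring A] [Algebra ℂ A]

/-- An isomorphism of modules. -/
structure Iso (M N : FinMod.{u} A) where
  equiv : M.carrier ≃ₗ[ℂ] N.carrier
  map_act : ∀ (a : A) (x : M.carrier), equiv (M.act a x) = N.act a (equiv x)

/-- The subspace `W` is a submodule. -/
def IsInvariant (M : FinMod.{u} A) (W : Submodule ℂ M.carrier) : Prop :=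
  ∀ (a : A), ∀ x ∈ W, M.act a x ∈ W

/-- `M` is nonzero and has no submodules but `0` and `M`. -/
def IsSimple (M : FinMod.{u} A) : Prop :=
  Nontrivial M.carrier ∧ ∀ W : Submodule ℂ M.carrier, M.IsInvariant W → W = ⊥ ∨ W = ⊤

/-- `M` is nonzero and is not the direct sum of two nonzero submodules. -/
def IsIndecomposable (M : FinMod.{u} A) : Prop :=
  Nontrivial M.carrier ∧ ∀ V W : Submodule ℂ M.carrier, M.IsInvariant V → M.IsInvariant W →
    IsCompl V W → V = ⊥ ∨ W = ⊥

/-- The dimension of `M` over `ℂ`. -/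
noncomputable def dim (M : FinMod.{u} A) : ℕ := Module.finrank ℂ M.carrier

/-- The direct sum of a finite family of modules. -/
@[reducible] def directSum {r : ℕ} (P : Fin r → FinMod.{u} A) : FinMod.{u} A where
  carrier := ∀ i, (P i).carrier
  act :=
    { toFun := fun a => LinearMap.pi fun i => (P i).act a ∘ₗ LinearMap.proj i
      map_one' := by refine LinearMap.ext fun x => funext fun i => ?_; simp
      map_mul' := fun a b => by refine LinearMap.ext fun x => funext fun i => ?_; simp
      map_zero' := by refine LinearMap.ext fun x => funext fun i => ?_; simp
      map_add' := fun a b => by refine LinearMap.ext fun x => funext fun i => ?_; simp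
      commutes' := fun c => by refine LinearMap.ext fun x => funext fun i => ?_; simp [Module.algebraMap_end_apply] }

end General

variable {D : RootDatum}

/-- The tensor product over `ℂ` of two `u_q⁺`-modules, with the action through `Δ`. -/
@[reducible] noncomputable def tensor (M N : FinMod.{u} (UqPlus D)) : FinMod.{u} (UqPlus D) where
  carrier := M.carrier ⊗[ℂ] N.carrier
  act := (Module.endTensorEndAlgHom (R := ℂ) (S := ℂ) (A := ℂ)).comp
    ((Algebra.TensorProduct.map M.act N.act).comp (UqPlus.comul D))

/-- The restriction of a `u_q`-module to `u_q⁺`. -/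
@[reducible] def restrict (X : FinMod.{u} (Uq D)) : FinMod.{u} (UqPlus D) where
  carrier := X.carrier
  act := X.act.comp (UqPlus D).val

/-- `M` is extendable: there is an action of `u_q` on the space `M` that restricts to the given
action of `u_q⁺`. -/
def IsExtendable (M : FinMod.{u} (UqPlus D)) : Prop :=
  ∃ act' : Uq D →ₐ[ℂ] Module.End ℂ M.carrier, act'.comp (UqPlus D).val = M.act

/-- `M` lies in the orbit of the extendable indecomposable modules under tensoring with simple
modules. -/
def InOrbit (M : FinMod.{u} (UqPlus D)) : Prop :=
  ∃ S X : FinMod.{u} (UqPlus D), S.IsSimple ∧ X.IsIndecomposable ∧ X.IsExtendable ∧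
    Nonempty (Iso M (tensor S X))

/-- `M` is isomorphic to the module `M_i^u`: it has a basis `e_0, …, e_u` with
`K e_j = q^{2(i+j)} e_j`, `E e_j = e_{j+1}` for `j < u`, and `E e_u = 0`. -/
def IsStandard (M : FinMod.{u} (UqPlus D)) (i : ZMod D.d) (u : ℕ) : Prop :=
  ∃ e : Module.Basis (Fin (u + 1)) ℂ M.carrier, ∀ j : Fin (u + 1),
    M.act (UqPlus.K D) (e j) = D.q ^ (2 * (i.val + (j : ℕ))) • e j ∧
    M.act (UqPlus.E D) (e j) = if h : (j : ℕ) + 1 < u + 1 then e ⟨(j : ℕ) + 1, h⟩ else 0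

/-! ### The isomorphisms given by the `R`-matrix -/

/-- The action of `τ R` from `X ⊗ Y` to `Y ⊗ X`, for `u_q`-modules `X` and `Y`, where `τ` is the
flip. -/
noncomputable def tauR (X Y : FinMod.{u} (Uq D)) :
    X.carrier ⊗[ℂ] Y.carrier →ₗ[ℂ] Y.carrier ⊗[ℂ] X.carrier :=
  (TensorProduct.comm ℂ X.carrier Y.carrier).toLinearMap ∘ₗ
    Module.endTensorEndAlgHom (R := ℂ) (S := ℂ) (A := ℂ)
      (Algebra.TensorProduct.map X.act Y.act (Uq.rMatrix D))

/-- For an isomorphism `k : X ⊗ T ≅ T ⊗ X`, the rearrangement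
`(S ⊗ X) ⊗ (T ⊗ Y) ≅ S ⊗ ((X ⊗ T) ⊗ Y) ≅ S ⊗ ((T ⊗ X) ⊗ Y) ≅ (S ⊗ T) ⊗ (X ⊗ Y)`
that applies `k` in the middle. -/
noncomputable def rearrange (S X T Y : FinMod.{u} (UqPlus D))
    (k : Iso (tensor X T) (tensor T X)) :
    (S.carrier ⊗[ℂ] X.carrier) ⊗[ℂ] (T.carrier ⊗[ℂ] Y.carrier) ≃ₗ[ℂ]
      (S.carrier ⊗[ℂ] T.carrier) ⊗[ℂ] (X.carrier ⊗[ℂ] Y.carrier) :=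
  (TensorProduct.assoc ℂ S.carrier X.carrier (T.carrier ⊗[ℂ] Y.carrier)).trans <|
    (TensorProduct.congr (LinearEquiv.refl ℂ S.carrier)
      ((TensorProduct.assoc ℂ X.carrier T.carrier Y.carrier).symm.trans <|
        (TensorProduct.congr k.equiv (LinearEquiv.refl ℂ Y.carrier)).trans <|
          TensorProduct.assoc ℂ T.carrier X.carrier Y.carrier)).trans <|
    (TensorProduct.assoc ℂ S.carrier T.carrier (X.carrier ⊗[ℂ] Y.carrier)).symm

/-- The isomorphism `f : M ⊗ N ≅ N ⊗ M` of `u_q⁺`-modules is given by the `R`-matrix of `u_q`: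
there are simple modules `S`, `T` and `u_q`-modules `X`, `Y`, indecomposable over `u_q⁺`, with
`M ≅ S ⊗ X` and `N ≅ T ⊗ Y`, such that `f` corresponds to (flip of `S`, `T`) `⊗ τ R` under
`M ⊗ N ≅ (S ⊗ X) ⊗ (T ⊗ Y) ≅ (S ⊗ T) ⊗ (X ⊗ Y)` and
`N ⊗ M ≅ (T ⊗ Y) ⊗ (S ⊗ X) ≅ (T ⊗ S) ⊗ (Y ⊗ X)`. -/
def IsRMatrixIso {M N : FinMod.{u} (UqPlus D)} (f : Iso (tensor M N) (tensor N M)) : Prop :=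
  ∃ (S T : FinMod.{u} (UqPlus D)) (X Y : FinMod.{u} (Uq D))
    (a : Iso M (tensor S X.restrict)) (b : Iso N (tensor T Y.restrict))
    (k : Iso (tensor X.restrict T) (tensor T X.restrict))
    (k' : Iso (tensor Y.restrict S) (tensor S Y.restrict)),
    S.IsSimple ∧ T.IsSimple ∧ X.restrict.IsIndecomposable ∧ Y.restrict.IsIndecomposable ∧
    ∀ z : M.carrier ⊗[ℂ] N.carrier,
      rearrange T Y.restrict S X.restrict k' (TensorProduct.congr b.equiv a.equiv (f.equiv z)) =
        TensorProduct.map (TensorProduct.comm ℂ S.carrier T.carrier).toLinearMap (tauR X Y)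
          (rearrange S X.restrict T Y.restrict k (TensorProduct.congr a.equiv b.equiv z))

/-- The isomorphism `f : M ⊗ N ≅ N ⊗ M` of `u_q⁺`-modules is blockwise given by the `R`-matrix:
`M` and `N` are direct sums of indecomposable modules `P i`, `Q j`, and `f` is the direct sum of
isomorphisms `P i ⊗ Q j ≅ Q j ⊗ P i` given by the `R`-matrix. -/
def IsBlockwiseRMatrixIso {M N : FinMod.{u} (UqPlus D)}
    (f : Iso (tensor M N) (tensor N M)) : Prop :=
  ∃ (r s : ℕ) (P : Fin r → FinMod.{u} (UqPlus D)) (Q : Fin s → FinMod.{u} (UqPlus D))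
    (a : Iso (directSum P) M) (b : Iso (directSum Q) N)
    (c : ∀ i j, Iso (tensor (P i) (Q j)) (tensor (Q j) (P i))),
    (∀ i, (P i).IsIndecomposable) ∧ (∀ j, (Q j).IsIndecomposable) ∧
    (∀ i j, IsRMatrixIso (c i j)) ∧
    ∀ i j, ∀ z : (P i).carrier ⊗[ℂ] (Q j).carrier,
      f.equiv (TensorProduct.map
          (a.equiv.toLinearMap ∘ₗ LinearMap.single ℂ (fun i => (P i).carrier) i)
          (b.equiv.toLinearMap ∘ₗ LinearMap.single ℂ (fun j => (Q j).carrier) j) z) =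
        TensorProduct.map
          (b.equiv.toLinearMap ∘ₗ LinearMap.single ℂ (fun j => (Q j).carrier) j)
          (a.equiv.toLinearMap ∘ₗ LinearMap.single ℂ (fun i => (P i).carrier) i)
          ((c i j).equiv z)

end FinMod

end HalfQuantum

/-!
The proof rests on two facts: a classification of the indecomposable `u_q⁺`-modules, and the
intertwining property of the `R`-matrix for the generators `E` and `K`.

Classification. `K` is diagonalizable, `E` is nilpotent and shifts the weights of `K`. If `u` is the
largest exponent with `E ^ u ≠ 0` on `M`, a weight vector `v` with `E ^ u v ≠ 0` spans a "string"
`v, E v, …, E ^ u v`, and the largest submodule in the kernel of a weight functional that is nonzero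
at `E ^ u v` is a complement (`exists_string_summand`). So the indecomposables are the strings
(`IsIndecomposable.exists_isString`, `IsString.isIndecomposable`), and every module is a sum of
strings (`exists_decomposition`). The simple modules are the strings of length one, and tensoring
with them multiplies the lowest weight of a string by a power of `q ^ 2`.

Extension. On a string with lowest weight `q ^ (2 j)` the relation
`E F - F E = (K - K⁻¹) / (q - q⁻¹)` determines `F` recursively, and the only condition
is that the trace of `K - K⁻¹` along the string vanishes (`exists_uq_action`). For length `u + 1`
this holds if `2 j + u ≡ 0` modulo `d`, where the weights are symmetric under inversion. Such a `j` exists if `d` is odd or `u` is even; then every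
string of length `u + 1` is a tensor product of a simple module and an extendable string
(`IsString.exists_iso_tensor`). The condition also holds for strings of length `d`, which
provides the characters of `u_q⁺` (`UqPlus.exists_character`).

The `R`-matrix. It factors as a diagonal part times a polynomial in the nilpotent `E ⊗ F`
(`rMatrix_eq`). Each factor is invertible and has a simple commutation rule with `E`, and together
they give `Δᵒᵖ(E) R = R Δ(E)` (`rMatrix_comul_E`). So `τ R` is an isomorphism of `u_q⁺`-modules
(`tauRIso`). A simple module commutes with every module up to a power of `K`
(`IsString.nonempty_iso_tensor_comm`), so the isomorphism `M ⊗ N ≅ N ⊗ M` can be composed from these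
ingredients (`exists_isRMatrixIso`), and block by block for arbitrary modules (`Iso.block`).
-/

namespace HalfQuantum

/-! ### Spectral projections of an element of finite order -/

section SpectralProj

variable {A : Type*} [Ring A] [Algebra ℂ A] {z : ℂ} {d : ℕ}

/-- For `k ^ d = 1` and a primitive `d`-th root of unity `z`, the idempotent projecting onto the
eigenvectors of `k` for the eigenvalue `z ^ a`. -/
noncomputable def spectralProj (z : ℂ) (d : ℕ) (k : A) (a : ℕ) : A :=
  (d : ℂ)⁻¹ • ∑ i ∈ Finset.range d, z⁻¹ ^ (a * i) • k ^ i

theorem sum_range_shift {B : Type*} [AddCommMonoid B] (g : ℕ → B) (d : ℕ) (h : g d = g 0) :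
    ∑ i ∈ Finset.range d, g (i + 1) = ∑ i ∈ Finset.range d, g i := by
  cases d with
  | zero => rfl
  | succ d => rw [Finset.sum_range_succ, h, Finset.sum_range_succ']

theorem mul_spectralProj (hd : 0 < d) (hz : IsPrimitiveRoot z d) {k : A} (hk : k ^ d = 1) (a : ℕ) :
    k * spectralProj z d k a = z ^ a • spectralProj z d k a := by
  have hz0 : z ≠ 0 := hz.ne_zero hd.ne'
  have hp : z⁻¹ ^ (a * d) = 1 := by rw [mul_comm, pow_mul, hz.inv.pow_eq_one, one_pow]
  rw [spectralProj, mul_smul_comm, smul_comm (z ^ a)]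
  congr 1
  conv_rhs => rw [← sum_range_shift (fun i => z⁻¹ ^ (a * i) • k ^ i) d (by simp [hk, hp])]
  rw [Finset.mul_sum, Finset.smul_sum]
  refine Finset.sum_congr rfl fun i _ => ?_
  rw [mul_smul_comm, ← pow_succ', smul_smul, mul_add, pow_add z⁻¹, mul_one, mul_left_comm,
    ← mul_pow, mul_inv_cancel₀ hz0, one_pow, mul_one]

theorem pow_mul_spectralProj (hd : 0 < d) (hz : IsPrimitiveRoot z d) {k : A} (hk : k ^ d = 1)
    (a i : ℕ) : k ^ i * spectralProj z d k a = z ^ (a * i) • spectralProj z d k a := by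
  induction i with
  | zero => simp
  | succ i ih =>
    rw [pow_succ, mul_assoc, mul_spectralProj hd hz hk, mul_smul_comm, ih, smul_smul, ← pow_add,
      mul_add, mul_one, add_comm]

theorem sum_pow_eq_zero {w : ℂ} (h : w ^ d = 1) (h1 : w ≠ 1) :
    ∑ i ∈ Finset.range d, w ^ i = 0 := by
  have := mul_geom_sum w d
  rw [h, sub_self] at this
  exact (mul_eq_zero.mp this).resolve_left (sub_ne_zero.mpr h1)

theorem sum_spectralProj (hd : 0 < d) (hz : IsPrimitiveRoot z d) (k : A) :
    ∑ a ∈ Finset.range d, spectralProj z d k a = 1 := by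
  have hd0 : (d : ℂ) ≠ 0 := Nat.cast_ne_zero.mpr hd.ne'
  simp only [spectralProj]
  rw [← Finset.smul_sum, Finset.sum_comm, Finset.sum_eq_single 0]
  · simp [← Nat.cast_smul_eq_nsmul ℂ, smul_smul, inv_mul_cancel₀ hd0]
  · intro i hi hi0
    rw [← Finset.sum_smul]
    have h := sum_pow_eq_zero (d := d) (w := z⁻¹ ^ i)
      (by rw [← pow_mul, mul_comm, pow_mul, hz.inv.pow_eq_one, one_pow])
      (hz.inv.pow_ne_one_of_pos_of_lt hi0 (Finset.mem_range.mp hi))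
    simp only [← pow_mul, mul_comm i] at h
    rw [h, zero_smul]
  · intro h
    exact absurd (Finset.mem_range.mpr hd) h

theorem spectralProj_mul_self (hd : 0 < d) (hz : IsPrimitiveRoot z d) {k : A} (hk : k ^ d = 1)
    (a : ℕ) : spectralProj z d k a * spectralProj z d k a = spectralProj z d k a := by
  have hd0 : (d : ℂ) ≠ 0 := Nat.cast_ne_zero.mpr hd.ne'
  have hz0 : z ≠ 0 := hz.ne_zero hd.ne'
  nth_rewrite 1 [spectralProj]
  rw [smul_mul_assoc, Finset.sum_mul]
  simp only [smul_mul_assoc, pow_mul_spectralProj hd hz hk, smul_smul, ← mul_pow,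
    inv_mul_cancel₀ hz0, one_pow, one_smul, Finset.sum_const, Finset.card_range]
  rw [← Nat.cast_smul_eq_nsmul ℂ, smul_smul, inv_mul_cancel₀ hd0, one_smul]

theorem spectralProj_mul_of_ne (hz : IsPrimitiveRoot z d) {k : A} (hk : k ^ d = 1)
    {a b : ℕ} (ha : a < d) (hb : b < d) (hab : a ≠ b) :
    spectralProj z d k a * spectralProj z d k b = 0 := by
  have hd : 0 < d := by omega
  have hz0 : z ≠ 0 := hz.ne_zero hd.ne'
  nth_rewrite 1 [spectralProj]
  rw [smul_mul_assoc, Finset.sum_mul]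
  simp only [smul_mul_assoc, pow_mul_spectralProj hd hz hk, smul_smul]
  rw [← Finset.sum_smul]
  have h := sum_pow_eq_zero (d := d) (w := z⁻¹ ^ a * z ^ b)
    (by rw [mul_pow, ← pow_mul, ← pow_mul, mul_comm a, mul_comm b, pow_mul, pow_mul,
      hz.inv.pow_eq_one, hz.pow_eq_one, one_pow, one_pow, one_mul])
    (fun h => hab (hz.pow_inj ha hb (by
      rw [inv_pow, inv_mul_eq_one₀ (pow_ne_zero _ hz0)] at h
      exact h)))
  simp only [mul_pow, ← pow_mul] at h
  rw [h, zero_smul, smul_zero]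

theorem spectralProj_period (hz : IsPrimitiveRoot z d) (k : A) :
    spectralProj z d k d = spectralProj z d k 0 := by
  simp only [spectralProj, pow_mul, hz.inv.pow_eq_one, one_pow, zero_mul, pow_zero]

theorem pow_mul_qcomm {k e : A} (h : k * e = z • (e * k)) (i : ℕ) :
    k ^ i * e = z ^ i • (e * k ^ i) := by
  induction i with
  | zero => simp
  | succ i ih =>
    rw [pow_succ', mul_assoc, ih, mul_smul_comm, ← mul_assoc, h, smul_mul_assoc, smul_smul,
      mul_assoc, pow_succ]

/-- An element `e` with `k e = z e k` shifts the eigenspaces of `k`. -/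
theorem spectralProj_succ_mul (hz0 : z ≠ 0) {k e : A} (h : k * e = z • (e * k)) (a : ℕ) :
    spectralProj z d k (a + 1) * e = e * spectralProj z d k a := by
  rw [spectralProj, spectralProj, smul_mul_assoc, mul_smul_comm, Finset.sum_mul, Finset.mul_sum]
  congr 1
  refine Finset.sum_congr rfl fun i _ => ?_
  rw [smul_mul_assoc, pow_mul_qcomm h, mul_smul_comm, smul_smul, add_mul, one_mul, pow_add,
    mul_assoc, ← mul_pow, inv_mul_cancel₀ hz0, one_pow, mul_one]

theorem spectralProj_commute {k e : A} (h : Commute k e) (a : ℕ) :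
    Commute (spectralProj z d k a) e := by
  refine Commute.smul_left (Commute.sum_left _ _ _ fun i _ => ?_) _
  exact (h.pow_left i).smul_left _

end SpectralProj

namespace RootDatum

variable (D : RootDatum)

theorem q_sq_ne_zero : D.q ^ 2 ≠ 0 := pow_ne_zero 2 D.q_ne_zero

theorem two_lt_d : 2 < D.d := by
  have h3 := D.three_le
  have h4 := D.ne_four
  unfold d
  split_ifs with h
  · omega
  · have : Even D.n := Nat.not_odd_iff_even.mp h
    obtain ⟨r, hr⟩ := this
    omega

theorem pow_sub_inv_pow_ne_zero {m : ℕ} (h0 : 0 < m) (hm : m < D.d) :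
    D.q ^ m - D.q⁻¹ ^ m ≠ 0 := by
  intro h
  have hq : D.q ^ m ≠ 0 := pow_ne_zero _ D.q_ne_zero
  refine D.sq_prim.pow_ne_one_of_pos_of_lt h0.ne' hm ?_
  rw [sub_eq_zero, inv_pow] at h
  rw [← pow_mul, mul_comm, pow_mul, sq]
  nth_rewrite 1 [h]
  exact inv_mul_cancel₀ hq

theorem q_sub_inv_ne_zero : D.q - D.q⁻¹ ≠ 0 := by
  simpa using D.pow_sub_inv_pow_ne_zero one_pos (by have := D.two_lt_d; omega)

variable {D}

/-- A half of `-u` modulo `d`, for `d` odd. -/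
theorem exists_dvd_of_odd (h : Odd D.d) (u : ℕ) : ∃ j, D.d ∣ 2 * j + u := by
  obtain ⟨r, hr⟩ := h
  exact ⟨r * u, u, by rw [hr]; ring⟩

variable (D)

/-- A half of `-u` modulo `d`, for `u` even. -/
theorem exists_dvd_of_even {u : ℕ} (h : Even u) : ∃ j, D.d ∣ 2 * j + u := by
  obtain ⟨r, rfl⟩ := h
  obtain ⟨m, hm⟩ := Nat.exists_eq_add_of_le' D.d_pos
  exact ⟨m * r, 2 * r, by rw [hm]; ring⟩

end RootDatum

/-! ### The `R`-matrix intertwines the comultiplication with its opposite -/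

namespace Uq

variable (D : RootDatum)

theorem qInt_ne_zero {m : ℕ} (h0 : 0 < m) (hm : m < D.d) : qInt D m ≠ 0 :=
  div_ne_zero (D.pow_sub_inv_pow_ne_zero h0 hm) D.q_sub_inv_ne_zero

theorem qFactorial_ne_zero {k : ℕ} (hk : k < D.d) : qFactorial D k ≠ 0 :=
  Finset.prod_ne_zero_iff.mpr fun m hm =>
    qInt_ne_zero D (by omega) (by have := Finset.mem_range.mp hm; omega)

theorem E_mul_F_pow (k : ℕ) :
    E D * F D ^ (k + 1) = F D ^ (k + 1) * E D + (qInt D (k + 1) / (D.q - D.q⁻¹)) •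
      (F D ^ k * (D.q⁻¹ ^ k • K D - D.q ^ k • Kinv D)) := by
  have hq := D.q_ne_zero
  have hs := D.q_sub_inv_ne_zero
  have e1 : E D * F D = F D * E D + (D.q - D.q⁻¹)⁻¹ • (K D - Kinv D) := by
    rw [← E_F]; abel
  have hK : K D * F D = (D.q⁻¹ ^ 2) • (F D * K D) := by rw [K_F, inv_pow]
  have hKi : Kinv D * F D = D.q ^ 2 • (F D * Kinv D) := by
    rw [F_Kinv, smul_smul, mul_inv_cancel₀ D.q_sq_ne_zero, one_smul]
  induction k with
  | zero =>
    rw [pow_one, pow_zero, one_mul, e1, qInt]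
    simp [div_self hs]
  | succ k ih =>
    rw [pow_succ (F D) (k + 1), ← mul_assoc, ih, add_mul, mul_assoc, e1, smul_mul_assoc,
      mul_assoc (F D ^ k), sub_mul, smul_mul_assoc, smul_mul_assoc, hK, hKi]
    simp only [mul_add, mul_sub, mul_smul_comm, smul_sub, smul_smul, ← mul_assoc, ← pow_succ]
    rw [add_assoc]
    congr 1
    rw [sub_add_sub_comm, ← add_smul, ← add_smul]
    have h2 : ∀ m : ℕ, D.q ^ m * D.q⁻¹ ^ m = 1 := fun m => by
      rw [← mul_pow, mul_inv_cancel₀ hq, one_pow]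
    have hkk := h2 k
    have h1 := h2 1
    rw [pow_one, pow_one] at h1
    have hs2 : (D.q - D.q⁻¹)⁻¹ = (D.q - D.q⁻¹) / (D.q - D.q⁻¹) / (D.q - D.q⁻¹) := by
      rw [div_self hs, one_div]
    simp only [qInt, pow_succ, hs2]
    generalize D.q⁻¹ ^ k = P at *
    generalize D.q⁻¹ = p at *
    generalize D.q ^ k = Q at *
    congr 2
    · linear_combination (((D.q - p)⁻¹) ^ 2) * ((D.q * p * p - D.q * D.q * p) * hkk +
        (p - D.q) * h1)
    · linear_combination (-((D.q - p)⁻¹) ^ 2) * ((D.q * D.q * p - D.q * p * p) * hkk +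
        (D.q - p) * h1)

/-- The diagonal part `∑ₐ pₐ ⊗ K ^ a` of the `R`-matrix, with `pₐ` the projection to the weight
`q ^ (2 a)`; it acts on vectors of weights `q ^ (2 a)`, `q ^ (2 b)` by `q ^ (2 a b)`. -/
noncomputable def cartanPart : Uq D ⊗[ℂ] Uq D :=
  ∑ a ∈ Finset.range D.d, spectralProj (D.q ^ 2) D.d (K D) a ⊗ₜ[ℂ] (K D ^ a)

/-- The coefficients `(q - q⁻¹) ^ k / [k]! q ^ (k (k - 1) / 2)` of the `R`-matrix. -/
noncomputable def thetaCoeff (k : ℕ) : ℂ :=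
  (D.q - D.q⁻¹) ^ k / qFactorial D k * D.q ^ (k * (k - 1) / 2)

/-- The unipotent part of the `R`-matrix. -/
noncomputable def theta : Uq D ⊗[ℂ] Uq D :=
  ∑ k ∈ Finset.range D.d, thetaCoeff D k • ((E D ^ k) ⊗ₜ[ℂ] (F D ^ k))

theorem K_pow_mul_F_pow (j k : ℕ) :
    K D ^ j * F D ^ k = (D.q ^ 2)⁻¹ ^ (j * k) • (F D ^ k * K D ^ j) := by
  have h := mul_pow_qcomm (pow_mul_qcomm (K_F D) j) k
  rwa [← pow_mul] at h

theorem K_pow_mul_E_pow (j k : ℕ) :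
    K D ^ j * E D ^ k = (D.q ^ 2) ^ (j * k) • (E D ^ k * K D ^ j) := by
  have h := mul_pow_qcomm (pow_mul_qcomm (K_E D) j) k
  rwa [← pow_mul] at h

/-- The factorization of the `R`-matrix, obtained by moving the powers of `K` to the left of those
of `E` and `F`. -/
theorem rMatrix_eq : rMatrix D = cartanPart D * theta D := by
  have hq := D.q_ne_zero
  have hc : cartanPart D = (1 / (D.d : ℂ)) • ∑ i ∈ Finset.range D.d, ∑ j ∈ Finset.range D.d,
      (D.q ^ 2)⁻¹ ^ (i * j) • ((K D ^ i) ⊗ₜ[ℂ] (K D ^ j)) := by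
    rw [Finset.sum_comm, Finset.smul_sum]
    refine Finset.sum_congr rfl fun a _ => ?_
    rw [spectralProj, ← TensorProduct.smul_tmul', TensorProduct.sum_tmul, one_div]
    simp only [← TensorProduct.smul_tmul', mul_comm a]
  rw [rMatrix, hc, theta, smul_mul_assoc, Finset.sum_mul]
  congr 1
  refine Finset.sum_congr rfl fun i _ => ?_
  rw [Finset.sum_mul]
  refine Finset.sum_congr rfl fun j _ => ?_
  rw [Finset.mul_sum]
  refine Finset.sum_congr rfl fun k _ => ?_
  rw [smul_mul_assoc, mul_smul_comm, Algebra.TensorProduct.tmul_mul_tmul, K_pow_mul_F_pow,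
    K_pow_mul_E_pow, ← TensorProduct.smul_tmul', TensorProduct.tmul_smul, smul_smul, smul_smul,
    smul_smul]
  congr 1
  have hz : ∀ m : ℕ, (D.q ^ 2) ^ m = D.q ^ (2 * (m : ℤ)) := fun m => by
    rw [← pow_mul, ← zpow_natCast]; push_cast; rfl
  have hz' : ∀ m : ℕ, (D.q ^ 2)⁻¹ ^ m = D.q ^ (-2 * (m : ℤ)) := fun m => by
    rw [inv_pow, hz, neg_mul, zpow_neg]
  have key : D.q ^ (((k * (k - 1) / 2 : ℕ) : ℤ) + 2 * (k : ℤ) * ((i : ℤ) - (j : ℤ))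
        - 2 * (i : ℤ) * (j : ℤ)) = D.q ^ (k * (k - 1) / 2) * ((D.q ^ 2)⁻¹ ^ (i * j) *
          ((D.q ^ 2)⁻¹ ^ (j * k) * (D.q ^ 2) ^ (i * k))) := by
    rw [hz, hz', hz', ← zpow_natCast, ← zpow_add₀ hq, ← zpow_add₀ hq, ← zpow_add₀ hq]
    congr 1
    push_cast
    ring
  rw [key, thetaCoeff]
  ring

theorem thetaCoeff_succ {k : ℕ} (hk : k + 1 < D.d) :
    thetaCoeff D (k + 1) * (qInt D (k + 1) / (D.q - D.q⁻¹)) = thetaCoeff D k * D.q ^ k := by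
  have h1 := qInt_ne_zero D (Nat.succ_pos k) hk
  have h2 := qFactorial_ne_zero D (by omega : k < D.d)
  have h3 := D.q_sub_inv_ne_zero
  have e : (k + 1) * (k + 1 - 1) / 2 = k * (k - 1) / 2 + k := by
    rw [← Finset.sum_range_id, ← Finset.sum_range_id, Finset.sum_range_succ]
  have e2 : qFactorial D (k + 1) = qFactorial D k * qInt D (k + 1) := Finset.prod_range_succ _ _
  rw [thetaCoeff, thetaCoeff, e, e2, pow_add, pow_succ]
  generalize D.q - D.q⁻¹ = s at *
  generalize qInt D (k + 1) = t at *
  field_simp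
  rw [pow_add]

/-- The unipotent part intertwines `Δ(E)` with the comultiplication of `E` in which `K` is replaced
by `K⁻¹`; coefficient by coefficient this is the recursion `thetaCoeff_succ`. -/
theorem theta_intertwines :
    (1 ⊗ₜ[ℂ] E D + E D ⊗ₜ[ℂ] Kinv D) * theta D = theta D * (1 ⊗ₜ[ℂ] E D + E D ⊗ₜ[ℂ] K D) := by
  have hd : D.d = (D.d - 1) + 1 := by have := D.d_pos; omega
  have hKF : ∀ k, Kinv D * F D ^ k = (D.q ^ k * D.q ^ k) • (F D ^ k * Kinv D) := fun k => by
    have h : Kinv D * F D = D.q ^ 2 • (F D * Kinv D) := by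
      rw [F_Kinv, smul_smul, mul_inv_cancel₀ D.q_sq_ne_zero, one_smul]
    rw [mul_pow_qcomm h, ← pow_mul, two_mul, pow_add]
  -- the commutator of `1 ⊗ E` with `theta`, from the commutators of `E` with the powers of `F`
  have h1 : (1 ⊗ₜ[ℂ] E D) * theta D - theta D * (1 ⊗ₜ[ℂ] E D) =
      ∑ k ∈ Finset.range (D.d - 1), thetaCoeff D k •
        ((E D ^ (k + 1)) ⊗ₜ[ℂ] (F D ^ k * K D) -
          (D.q ^ k * D.q ^ k) • ((E D ^ (k + 1)) ⊗ₜ[ℂ] (F D ^ k * Kinv D))) := by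
    rw [theta, Finset.mul_sum, Finset.sum_mul, ← Finset.sum_sub_distrib, hd,
      Finset.sum_range_succ', Nat.add_sub_cancel]
    simp only [mul_smul_comm, smul_mul_assoc, Algebra.TensorProduct.tmul_mul_tmul, one_mul,
      mul_one, pow_zero, sub_self, add_zero]
    refine Finset.sum_congr rfl fun k hk => ?_
    have hk' : k + 1 < D.d := by have := Finset.mem_range.mp hk; omega
    have hq : D.q ^ k * D.q⁻¹ ^ k = 1 := by rw [← mul_pow, mul_inv_cancel₀ D.q_ne_zero, one_pow]
    rw [← smul_sub, ← TensorProduct.tmul_sub, E_mul_F_pow, add_sub_cancel_left,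
      TensorProduct.tmul_smul, smul_smul, thetaCoeff_succ D hk', mul_sub,
      TensorProduct.tmul_sub]
    simp only [mul_smul_comm, TensorProduct.tmul_smul, smul_sub, smul_smul]
    rw [mul_assoc, hq, mul_one, mul_assoc]
  have h2 : theta D * (E D ⊗ₜ[ℂ] K D) - (E D ⊗ₜ[ℂ] Kinv D) * theta D =
      ∑ k ∈ Finset.range (D.d - 1), thetaCoeff D k •
        ((E D ^ (k + 1)) ⊗ₜ[ℂ] (F D ^ k * K D) -
          (D.q ^ k * D.q ^ k) • ((E D ^ (k + 1)) ⊗ₜ[ℂ] (F D ^ k * Kinv D))) := by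
    rw [theta, Finset.mul_sum, Finset.sum_mul, ← Finset.sum_sub_distrib, hd,
      Finset.sum_range_succ, Nat.add_sub_cancel]
    simp only [mul_smul_comm, smul_mul_assoc, Algebra.TensorProduct.tmul_mul_tmul, ← pow_succ,
      ← pow_succ', ← hd, E_pow, TensorProduct.zero_tmul, smul_zero, sub_zero, add_zero, hKF,
      TensorProduct.tmul_smul, smul_sub]
  rw [add_mul, mul_add, ← sub_eq_zero]
  rw [← sub_eq_zero.mpr (h1.trans h2.symm)]
  abel

/-- The unipotent part is a polynomial in the nilpotent element `E ⊗ F` with constant term `1`. -/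
theorem isUnit_theta : IsUnit (theta D) := by
  have hd : D.d = (D.d - 1) + 1 := by have := D.d_pos; omega
  have hpow : ∀ k, (E D ⊗ₜ[ℂ] F D) ^ k = (E D ^ k) ⊗ₜ[ℂ] (F D ^ k) := fun k =>
    Algebra.TensorProduct.tmul_pow _ _ _
  have h : theta D = 1 + (E D ⊗ₜ[ℂ] F D) *
      ∑ k ∈ Finset.range (D.d - 1), thetaCoeff D (k + 1) • (E D ⊗ₜ[ℂ] F D) ^ k := by
    rw [theta, hd, Finset.sum_range_succ', Finset.mul_sum, add_comm, Nat.add_sub_cancel]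
    congr 1
    · simp [thetaCoeff, qFactorial, Algebra.TensorProduct.one_def]
    · refine Finset.sum_congr rfl fun k _ => ?_
      rw [mul_smul_comm, ← pow_succ', hpow]
  rw [h]
  refine IsNilpotent.isUnit_one_add (Commute.isNilpotent_mul_right ?_ ⟨D.d, ?_⟩)
  · exact Commute.sum_right _ _ _ fun k _ => ((Commute.refl _).pow_right k).smul_right _
  · rw [hpow, E_pow, TensorProduct.zero_tmul]

/-- Multiplying by the diagonal part turns `1 ⊗ E` into `K ⊗ E` and `E ⊗ K⁻¹` into `E ⊗ 1`, since
`E` raises the weight by one step. -/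
theorem cartanPart_intertwines :
    (E D ⊗ₜ[ℂ] 1 + K D ⊗ₜ[ℂ] E D) * cartanPart D =
      cartanPart D * (1 ⊗ₜ[ℂ] E D + E D ⊗ₜ[ℂ] Kinv D) := by
  have hz := D.sq_prim
  have h1 : cartanPart D * (1 ⊗ₜ[ℂ] E D) = (K D ⊗ₜ[ℂ] E D) * cartanPart D := by
    rw [cartanPart, Finset.sum_mul, Finset.mul_sum]
    refine Finset.sum_congr rfl fun a _ => ?_
    rw [Algebra.TensorProduct.tmul_mul_tmul, Algebra.TensorProduct.tmul_mul_tmul, mul_one,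
      mul_spectralProj D.d_pos hz (K_pow D), pow_mul_qcomm (K_E D), TensorProduct.tmul_smul,
      TensorProduct.smul_tmul']
  have h2 : cartanPart D * (E D ⊗ₜ[ℂ] Kinv D) = (E D ⊗ₜ[ℂ] 1) * cartanPart D := by
    rw [cartanPart, Finset.sum_mul, Finset.mul_sum]
    rw [← sum_range_shift]
    · refine Finset.sum_congr rfl fun a _ => ?_
      rw [Algebra.TensorProduct.tmul_mul_tmul, Algebra.TensorProduct.tmul_mul_tmul, one_mul,
        spectralProj_succ_mul D.q_sq_ne_zero (K_E D), pow_succ (K D), mul_assoc (K D ^ a),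
        K_mul_Kinv, mul_one]
    · rw [spectralProj_period hz, K_pow, pow_zero]
  rw [add_mul, mul_add, h1, h2, add_comm]

theorem cartanPart_right_inverse :
    cartanPart D * (∑ a ∈ Finset.range D.d,
      spectralProj (D.q ^ 2) D.d (K D) a ⊗ₜ[ℂ] (Kinv D ^ a)) = 1 := by
  have hz := D.sq_prim
  have hc : Commute (K D) (Kinv D) := by rw [Commute, SemiconjBy, K_mul_Kinv, Kinv_mul_K]
  rw [cartanPart, Finset.sum_mul, Algebra.TensorProduct.one_def]
  nth_rewrite 1 [← sum_spectralProj D.d_pos hz (K D)]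
  rw [TensorProduct.sum_tmul]
  refine Finset.sum_congr rfl fun a ha => ?_
  rw [Finset.mul_sum, Finset.sum_eq_single a]
  · rw [Algebra.TensorProduct.tmul_mul_tmul, spectralProj_mul_self D.d_pos hz (K_pow D),
      ← hc.mul_pow, K_mul_Kinv, one_pow]
  · intro b hb hba
    rw [Algebra.TensorProduct.tmul_mul_tmul, spectralProj_mul_of_ne hz (K_pow D)
      (Finset.mem_range.mp ha) (Finset.mem_range.mp hb) hba.symm, TensorProduct.zero_tmul]
  · exact fun h => absurd ha h

theorem exists_rMatrix_mul_eq_one : ∃ S : Uq D ⊗[ℂ] Uq D, rMatrix D * S = 1 := by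
  obtain ⟨t, ht⟩ := isUnit_theta D
  have h := cartanPart_right_inverse D
  refine ⟨↑t⁻¹ * ∑ a ∈ Finset.range D.d,
    spectralProj (D.q ^ 2) D.d (K D) a ⊗ₜ[ℂ] (Kinv D ^ a), ?_⟩
  rw [rMatrix_eq, ← ht, mul_assoc, Units.mul_inv_cancel_left, h]

/-- `Δᵒᵖ(E) R = R Δ(E)`. -/
theorem rMatrix_comul_E :
    (E D ⊗ₜ[ℂ] 1 + K D ⊗ₜ[ℂ] E D) * rMatrix D = rMatrix D * comul D (E D) := by
  rw [rMatrix_eq, ← mul_assoc, cartanPart_intertwines, mul_assoc, theta_intertwines, comul_E,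
    mul_assoc]

/-- `Δᵒᵖ(K) R = R Δ(K)`. -/
theorem rMatrix_comul_K :
    (K D ⊗ₜ[ℂ] K D) * rMatrix D = rMatrix D * comul D (K D) := by
  rw [comul_K, rMatrix_eq]
  refine Commute.mul_right (Commute.sum_right _ _ _ fun a _ => ?_)
    (Commute.sum_right _ _ _ fun k _ => Commute.smul_right ?_ _)
  · have h1 := spectralProj_commute (z := D.q ^ 2) (d := D.d) (Commute.refl (K D)) a
    have h2 : Commute (K D) (K D ^ a) := (Commute.refl _).pow_right a
    rw [Commute, SemiconjBy, Algebra.TensorProduct.tmul_mul_tmul,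
      Algebra.TensorProduct.tmul_mul_tmul, h1.eq, h2.eq]
  · have hE := mul_pow_qcomm (K_E D) k
    have hF := mul_pow_qcomm (K_F D) k
    rw [Commute, SemiconjBy, Algebra.TensorProduct.tmul_mul_tmul,
      Algebra.TensorProduct.tmul_mul_tmul, hE, hF, TensorProduct.tmul_smul,
      ← TensorProduct.smul_tmul', smul_smul, ← mul_pow, inv_mul_cancel₀ D.q_sq_ne_zero, one_pow,
      one_smul]

end Uq

/-! ### Modules over `u_q⁺` through the action of the generators -/

namespace UqPlus

variable {D : RootDatum}

theorem induction {p : UqPlus D → Prop} (hE : p (E D)) (hK : p (K D))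
    (halg : ∀ c : ℂ, p (algebraMap ℂ (UqPlus D) c)) (hadd : ∀ a b, p a → p b → p (a + b))
    (hmul : ∀ a b, p a → p b → p (a * b)) (a : UqPlus D) : p a := by
  obtain ⟨x, hx⟩ := a
  refine Algebra.adjoin_induction (p := fun x hx => p ⟨x, hx⟩) ?_ (fun c => halg c)
    (fun x y hx hy h1 h2 => hadd ⟨x, hx⟩ ⟨y, hy⟩ h1 h2)
    (fun x y hx hy h1 h2 => hmul ⟨x, hx⟩ ⟨y, hy⟩ h1 h2) hx
  rintro y (rfl | rfl)
  · exact hE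
  · exact hK

variable (D)

theorem E_pow : E D ^ D.d = 0 := Subtype.ext (Uq.E_pow D)

theorem K_pow : K D ^ D.d = 1 := Subtype.ext (Uq.K_pow D)

theorem K_E : K D * E D = D.q ^ 2 • (E D * K D) := Subtype.ext (Uq.K_E D)

theorem comul_E : comul D (E D) = 1 ⊗ₜ[ℂ] E D + E D ⊗ₜ[ℂ] K D := by
  refine tensorIncl_injective D ?_
  rw [tensorIncl_comul]
  simp [tensorIncl, E, K, Uq.comul_E]

theorem comul_K : comul D (K D) = K D ⊗ₜ[ℂ] K D := by
  refine tensorIncl_injective D ?_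
  rw [tensorIncl_comul]
  simp [tensorIncl, K, Uq.comul_K]

end UqPlus

namespace FinMod

section General

variable {A : Type} [Ring A] [Algebra ℂ A]

/-- The identity isomorphism. -/
def Iso.refl (M : FinMod.{u} A) : Iso M M := ⟨LinearEquiv.refl ℂ _, fun _ _ => rfl⟩

/-- The inverse of an isomorphism. -/
def Iso.symm {M N : FinMod.{u} A} (f : Iso M N) : Iso N M :=
  ⟨f.equiv.symm, fun a x => by
    rw [LinearEquiv.symm_apply_eq, f.map_act, LinearEquiv.apply_symm_apply]⟩

/-- The composite of two isomorphisms. -/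
def Iso.trans {M N P : FinMod.{u} A} (f : Iso M N) (g : Iso N P) : Iso M P :=
  ⟨f.equiv.trans g.equiv, fun a x => by
    rw [LinearEquiv.trans_apply, f.map_act, g.map_act, LinearEquiv.trans_apply]⟩

end General

variable {D : RootDatum}

theorem act_K_E (M : FinMod.{u} (UqPlus D)) (x : M.carrier) :
    M.act (UqPlus.K D) (M.act (UqPlus.E D) x) =
      D.q ^ 2 • M.act (UqPlus.E D) (M.act (UqPlus.K D) x) := by
  rw [← Module.End.mul_apply, ← map_mul, UqPlus.K_E, map_smul, map_mul]
  rfl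

theorem act_E_pow_d (M : FinMod.{u} (UqPlus D)) : M.act (UqPlus.E D) ^ D.d = 0 := by
  rw [← map_pow, UqPlus.E_pow, map_zero]

theorem act_K_pow_d (M : FinMod.{u} (UqPlus D)) : M.act (UqPlus.K D) ^ D.d = 1 := by
  rw [← map_pow, UqPlus.K_pow, map_one]

theorem tensor_act_E (M N : FinMod.{u} (UqPlus D)) (m : M.carrier) (n : N.carrier) :
    (tensor M N).act (UqPlus.E D) (m ⊗ₜ[ℂ] n) =
      m ⊗ₜ[ℂ] N.act (UqPlus.E D) n + M.act (UqPlus.E D) m ⊗ₜ[ℂ] N.act (UqPlus.K D) n := by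
  simp [tensor, UqPlus.comul_E, Module.endTensorEndAlgHom_apply]

theorem tensor_act_K (M N : FinMod.{u} (UqPlus D)) (m : M.carrier) (n : N.carrier) :
    (tensor M N).act (UqPlus.K D) (m ⊗ₜ[ℂ] n) =
      M.act (UqPlus.K D) m ⊗ₜ[ℂ] N.act (UqPlus.K D) n := by
  simp [tensor, UqPlus.comul_K, Module.endTensorEndAlgHom_apply]

theorem map_act_of_generators {M N : FinMod.{u} (UqPlus D)} (f : M.carrier →ₗ[ℂ] N.carrier)
    (hE : f ∘ₗ M.act (UqPlus.E D) = N.act (UqPlus.E D) ∘ₗ f)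
    (hK : f ∘ₗ M.act (UqPlus.K D) = N.act (UqPlus.K D) ∘ₗ f) (a : UqPlus D) (x : M.carrier) :
    f (M.act a x) = N.act a (f x) := by
  induction a using UqPlus.induction generalizing x with
  | hE => exact LinearMap.congr_fun hE x
  | hK => exact LinearMap.congr_fun hK x
  | halg c => simp [Module.algebraMap_end_apply]
  | hadd a b ha hb => simp [ha, hb]
  | hmul a b ha hb => simp [ha, hb]

theorem isInvariant_of_generators {M : FinMod.{u} (UqPlus D)} {W : Submodule ℂ M.carrier}
    (hE : ∀ x ∈ W, M.act (UqPlus.E D) x ∈ W) (hK : ∀ x ∈ W, M.act (UqPlus.K D) x ∈ W) :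
    M.IsInvariant W := by
  intro a
  induction a using UqPlus.induction with
  | hE => exact hE
  | hK => exact hK
  | halg c => intro x hx; simpa [Module.algebraMap_end_apply] using W.smul_mem c hx
  | hadd a b ha hb => intro x hx; simpa using W.add_mem (ha x hx) (hb x hx)
  | hmul a b ha hb => intro x hx; simpa using ha _ (hb x hx)

/-- A linear isomorphism that commutes with `E` and `K` is an isomorphism of modules. -/
def Iso.ofGenerators {M N : FinMod.{u} (UqPlus D)} (f : M.carrier ≃ₗ[ℂ] N.carrier)
    (hE : f.toLinearMap ∘ₗ M.act (UqPlus.E D) = N.act (UqPlus.E D) ∘ₗ f.toLinearMap)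
    (hK : f.toLinearMap ∘ₗ M.act (UqPlus.K D) = N.act (UqPlus.K D) ∘ₗ f.toLinearMap) : Iso M N :=
  ⟨f, map_act_of_generators f.toLinearMap hE hK⟩

/-- The tensor product of two isomorphisms. -/
noncomputable def Iso.tensor {M M' N N' : FinMod.{u} (UqPlus D)} (f : Iso M M') (g : Iso N N') :
    Iso (M.tensor N) (M'.tensor N') :=
  Iso.ofGenerators (TensorProduct.congr f.equiv g.equiv)
    (TensorProduct.ext' fun x y => by
      rw [LinearMap.comp_apply, LinearMap.comp_apply, LinearEquiv.coe_coe, tensor_act_E, map_add,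
        TensorProduct.congr_tmul, TensorProduct.congr_tmul, TensorProduct.congr_tmul,
        tensor_act_E, f.map_act, g.map_act, g.map_act])
    (TensorProduct.ext' fun x y => by
      rw [LinearMap.comp_apply, LinearMap.comp_apply, LinearEquiv.coe_coe, tensor_act_K,
        TensorProduct.congr_tmul, TensorProduct.congr_tmul, tensor_act_K, f.map_act, g.map_act])

/-- The associativity of the tensor product of modules. -/
noncomputable def Iso.assoc (M N P : FinMod.{u} (UqPlus D)) :
    Iso ((M.tensor N).tensor P) (M.tensor (N.tensor P)) :=
  Iso.ofGenerators (TensorProduct.assoc ℂ M.carrier N.carrier P.carrier)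
    (TensorProduct.ext_threefold fun x y z => by
      rw [LinearMap.comp_apply, LinearMap.comp_apply, LinearEquiv.coe_coe, tensor_act_E,
        tensor_act_E, TensorProduct.add_tmul, map_add, map_add, TensorProduct.assoc_tmul,
        TensorProduct.assoc_tmul, TensorProduct.assoc_tmul, TensorProduct.assoc_tmul,
        tensor_act_E, tensor_act_E, tensor_act_K, TensorProduct.tmul_add, add_assoc])
    (TensorProduct.ext_threefold fun x y z => by
      rw [LinearMap.comp_apply, LinearMap.comp_apply, LinearEquiv.coe_coe, tensor_act_K,
        tensor_act_K, TensorProduct.assoc_tmul, TensorProduct.assoc_tmul, tensor_act_K,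
        tensor_act_K])

/-- The linear map `rearrange` is an isomorphism of modules. -/
noncomputable def rearrangeIso (S X T Y : FinMod.{u} (UqPlus D))
    (k : Iso (tensor X T) (tensor T X)) :
    Iso ((S.tensor X).tensor (T.tensor Y)) ((S.tensor T).tensor (X.tensor Y)) :=
  (Iso.assoc S X (T.tensor Y)).trans <|
    ((Iso.refl S).tensor ((Iso.assoc X T Y).symm.trans <|
      (k.tensor (Iso.refl Y)).trans <| Iso.assoc T X Y)).trans <|
    (Iso.assoc S T (X.tensor Y)).symm

/-- The action of `u_q ⊗ u_q` on `X ⊗ Y`. -/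
noncomputable def tensorAct (X Y : FinMod.{u} (Uq D)) :
    Uq D ⊗[ℂ] Uq D →ₐ[ℂ] Module.End ℂ (X.carrier ⊗[ℂ] Y.carrier) :=
  (Module.endTensorEndAlgHom (R := ℂ) (S := ℂ) (A := ℂ)).comp
    (Algebra.TensorProduct.map X.act Y.act)

theorem tensorAct_tmul (X Y : FinMod.{u} (Uq D)) (a b : Uq D) (x : X.carrier) (y : Y.carrier) :
    tensorAct X Y (a ⊗ₜ[ℂ] b) (x ⊗ₜ[ℂ] y) = X.act a x ⊗ₜ[ℂ] Y.act b y := by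
  simp [tensorAct, Module.endTensorEndAlgHom_apply]

theorem tauR_eq (X Y : FinMod.{u} (Uq D)) :
    tauR X Y = (TensorProduct.comm ℂ X.carrier Y.carrier).toLinearMap ∘ₗ
      tensorAct X Y (Uq.rMatrix D) := rfl

theorem tauR_bijective (X Y : FinMod.{u} (Uq D)) : Function.Bijective (tauR X Y) := by
  obtain ⟨S, hS⟩ := Uq.exists_rMatrix_mul_eq_one D
  have h1 : tensorAct X Y (Uq.rMatrix D) * tensorAct X Y S = 1 := by
    rw [← map_mul, hS, map_one]
  have h2 : Function.Surjective (tensorAct X Y (Uq.rMatrix D)) := fun z =>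
    ⟨tensorAct X Y S z, LinearMap.congr_fun h1 z⟩
  have h3 := LinearMap.injective_iff_surjective.mpr h2
  exact (TensorProduct.comm ℂ X.carrier Y.carrier).bijective.comp ⟨h3, h2⟩

/-- The braiding `τ R` as an isomorphism of `u_q⁺`-modules. -/
noncomputable def tauRIso (X Y : FinMod.{u} (Uq D)) :
    Iso (X.restrict.tensor Y.restrict) (Y.restrict.tensor X.restrict) :=
  Iso.ofGenerators (LinearEquiv.ofBijective (tauR X Y) (tauR_bijective X Y))
    (by
      have h1 : (X.restrict.tensor Y.restrict).act (UqPlus.E D) =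
          tensorAct X Y (Uq.comul D (Uq.E D)) := TensorProduct.ext' fun x y => by
        rw [tensor_act_E, Uq.comul_E, map_add, LinearMap.add_apply, tensorAct_tmul,
          tensorAct_tmul, map_one]
        rfl
      have h2 : (TensorProduct.comm ℂ X.carrier Y.carrier).toLinearMap ∘ₗ
          tensorAct X Y (Uq.E D ⊗ₜ[ℂ] 1 + Uq.K D ⊗ₜ[ℂ] Uq.E D) =
          (Y.restrict.tensor X.restrict).act (UqPlus.E D) ∘ₗ
            (TensorProduct.comm ℂ X.carrier Y.carrier).toLinearMap :=
        TensorProduct.ext' fun x y => by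
          rw [LinearMap.comp_apply, LinearMap.comp_apply, LinearEquiv.coe_coe,
            TensorProduct.comm_tmul, tensor_act_E, map_add, LinearMap.add_apply, tensorAct_tmul,
            tensorAct_tmul, map_one, map_add]
          rfl
      change tauR X Y ∘ₗ _ = _ ∘ₗ tauR X Y
      rw [h1, tauR_eq, ← LinearMap.comp_assoc, ← h2, LinearMap.comp_assoc, LinearMap.comp_assoc]
      congr 1
      rw [← Module.End.mul_eq_comp, ← Module.End.mul_eq_comp, ← map_mul, ← map_mul,
        Uq.rMatrix_comul_E])
    (by
      have h1 : (X.restrict.tensor Y.restrict).act (UqPlus.K D) =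
          tensorAct X Y (Uq.comul D (Uq.K D)) := TensorProduct.ext' fun x y => by
        rw [tensor_act_K, Uq.comul_K, tensorAct_tmul]
        rfl
      have h2 : (TensorProduct.comm ℂ X.carrier Y.carrier).toLinearMap ∘ₗ
          tensorAct X Y (Uq.K D ⊗ₜ[ℂ] Uq.K D) =
          (Y.restrict.tensor X.restrict).act (UqPlus.K D) ∘ₗ
            (TensorProduct.comm ℂ X.carrier Y.carrier).toLinearMap :=
        TensorProduct.ext' fun x y => by
          rw [LinearMap.comp_apply, LinearMap.comp_apply, LinearEquiv.coe_coe,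
            TensorProduct.comm_tmul, tensor_act_K, tensorAct_tmul]
          rfl
      change tauR X Y ∘ₗ _ = _ ∘ₗ tauR X Y
      rw [h1, tauR_eq, ← LinearMap.comp_assoc, ← h2, LinearMap.comp_assoc, LinearMap.comp_assoc]
      congr 1
      rw [← Module.End.mul_eq_comp, ← Module.End.mul_eq_comp, ← map_mul, ← map_mul,
        Uq.rMatrix_comul_K])

end FinMod

/-! ### Strings: cyclic vectors for a nilpotent operator -/

section LinearAlgebra

variable {V : Type*} [AddCommGroup V] [Module ℂ V]

theorem pow_apply_eq_zero_of_lt {T : Module.End ℂ V} {x : V} {u m : ℕ}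
    (hx : (T ^ (u + 1)) x = 0) (hm : u < m) : (T ^ m) x = 0 := by
  obtain ⟨r, rfl⟩ := Nat.exists_eq_add_of_le' hm
  rw [pow_add, Module.End.mul_apply, hx, map_zero]

/-- A functional not vanishing on the last vector of a string `x, T x, …, T ^ u x` pairs the string
with itself by an invertible anti-triangular matrix. -/
theorem string_pairing_injective {T : Module.End ℂ V} {x : V} {u : ℕ} (hx : (T ^ (u + 1)) x = 0)
    {φ : V →ₗ[ℂ] ℂ} (hφ : φ ((T ^ u) x) ≠ 0) :
    Function.Injective ((LinearMap.pi fun k : Fin (u + 1) => φ ∘ₗ T ^ (k : ℕ)) ∘ₗ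
      Fintype.linearCombination ℂ fun k : Fin (u + 1) => (T ^ (k : ℕ)) x) := by
  rw [← LinearMap.ker_eq_bot, LinearMap.ker_eq_bot']
  intro c hc
  -- the row `u - l` of the pairing involves only the coefficients `c 0, …, c l`
  have key : ∀ l : ℕ, ∀ h : l < u + 1, c ⟨l, h⟩ = 0 := by
    intro l
    induction l using Nat.strong_induction_on with
    | _ l ih =>
      intro h
      have h1 := congrFun hc ⟨u - l, by omega⟩
      simp only [LinearMap.comp_apply, LinearMap.pi_apply, Fintype.linearCombination_apply,
        map_sum, map_smul, smul_eq_mul, Pi.zero_apply, ← Module.End.mul_apply, ← pow_add] at h1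
      rw [Finset.sum_eq_single ⟨l, h⟩] at h1
      · have e : u - l + l = u := by omega
        simp only [e] at h1
        exact (mul_eq_zero.mp h1).resolve_right hφ
      · rintro ⟨m, hm⟩ - hne
        have hne' : m ≠ l := fun h => hne (Fin.ext h)
        rcases lt_or_gt_of_ne hne' with h2 | h2
        · rw [ih m h2, zero_mul]
        · rw [pow_apply_eq_zero_of_lt hx (by simp only; omega), map_zero, mul_zero]
      · simp
  exact funext fun l => key l l.2

theorem string_linearIndependent {T : Module.End ℂ V} {x : V} {u : ℕ} (hx : (T ^ (u + 1)) x = 0)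
    (hu : (T ^ u) x ≠ 0) : LinearIndependent ℂ fun k : Fin (u + 1) => (T ^ (k : ℕ)) x := by
  obtain ⟨φ, hφ⟩ : ∃ φ : Module.Dual ℂ V, φ ((T ^ u) x) ≠ 0 := by
    by_contra! h
    exact hu ((Module.forall_dual_apply_eq_zero_iff ℂ _).mp h)
  have h := string_pairing_injective hx hφ
  rw [LinearMap.coe_comp] at h
  exact linearIndependent_iff_injective_fintypeLinearCombination.mpr h.of_comp

theorem span_range_string {T : Module.End ℂ V} {x : V} {u : ℕ}
    (hx : (T ^ (u + 1)) x = 0) :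
    Submodule.span ℂ (Set.range fun k : Fin (u + 1) => (T ^ (k : ℕ)) x) =
      Submodule.span ℂ (Set.range fun k : ℕ => (T ^ k) x) := by
  refine le_antisymm (Submodule.span_mono ?_) (Submodule.span_le.mpr ?_)
  · rintro _ ⟨k, rfl⟩
    exact ⟨k, rfl⟩
  · rintro _ ⟨k, rfl⟩
    by_cases hk : k < u + 1
    · exact Submodule.subset_span ⟨⟨k, hk⟩, rfl⟩
    · simp only
      rw [pow_apply_eq_zero_of_lt hx (by omega)]
      exact Submodule.zero_mem _

/-- If `f ∘ g` is bijective, the image of `g` is complementary to the kernel of `f`. -/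
theorem isCompl_range_ker {W U : Type*} [AddCommGroup W] [Module ℂ W] [AddCommGroup U] [Module ℂ U]
    {f : V →ₗ[ℂ] W} {g : U →ₗ[ℂ] V} (h : Function.Bijective (f ∘ₗ g)) :
    IsCompl (LinearMap.range g) (LinearMap.ker f) := by
  constructor
  · rw [Submodule.disjoint_def]
    rintro _ ⟨y, rfl⟩ hy
    have : y = 0 := h.1 (by rw [map_zero]; exact hy)
    rw [this, map_zero]
  · rw [codisjoint_iff, eq_top_iff]
    rintro v -
    obtain ⟨y, hy⟩ := h.2 (f v)
    refine Submodule.mem_sup.mpr ⟨g y, ⟨y, rfl⟩, v - g y, ?_, by abel⟩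
    rw [LinearMap.mem_ker, map_sub, ← hy, LinearMap.comp_apply, sub_self]

theorem tmul_ne_zero {W : Type*} [AddCommGroup W] [Module ℂ W] {x : V} {y : W} (hx : x ≠ 0)
    (hy : y ≠ 0) : x ⊗ₜ[ℂ] y ≠ 0 := by
  obtain ⟨φ, hφ⟩ : ∃ φ : Module.Dual ℂ V, φ x ≠ 0 := by
    by_contra! h
    exact hx ((Module.forall_dual_apply_eq_zero_iff ℂ _).mp h)
  obtain ⟨ψ, hψ⟩ : ∃ ψ : Module.Dual ℂ W, ψ y ≠ 0 := by
    by_contra! h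
    exact hy ((Module.forall_dual_apply_eq_zero_iff ℂ _).mp h)
  intro h
  have := congrArg ((TensorProduct.lid ℂ ℂ).toLinearMap ∘ₗ TensorProduct.map φ ψ) h
  exact mul_ne_zero hφ hψ (by simpa using this)

theorem spectralProj_apply_of_eigen {z : ℂ} {d : ℕ} (hd : 0 < d) (hz : IsPrimitiveRoot z d)
    {k : Module.End ℂ V} {x : V} {b : ℕ} (h : k x = z ^ b • x) : spectralProj z d k b x = x := by
  have hd0 : (d : ℂ) ≠ 0 := Nat.cast_ne_zero.mpr hd.ne'
  have hz0 : z ≠ 0 := hz.ne_zero hd.ne'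
  have hi : ∀ i : ℕ, (k ^ i) x = z ^ (b * i) • x := fun i => by
    induction i with
    | zero => simp
    | succ i ih => rw [pow_succ', Module.End.mul_apply, ih, map_smul, h, smul_smul, ← pow_add,
        mul_add, mul_one]
  simp only [spectralProj, LinearMap.smul_apply, LinearMap.sum_apply, hi, smul_smul, ← mul_pow,
    inv_mul_cancel₀ hz0, one_pow, one_smul, Finset.sum_const, Finset.card_range]
  rw [← Nat.cast_smul_eq_nsmul ℂ, smul_smul, inv_mul_cancel₀ hd0, one_smul]

end LinearAlgebra

/-! ### Classification of the indecomposable `u_q⁺`-modules -/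

namespace FinMod

/-- A submodule as a module. -/
@[reducible] def sub {A : Type} [Ring A] [Algebra ℂ A] (M : FinMod.{u} A)
    (W : Submodule ℂ M.carrier) (h : M.IsInvariant W) : FinMod.{u} A where
  carrier := W
  act :=
    { toFun := fun a => (M.act a).restrict (h a)
      map_one' := by refine LinearMap.ext fun x => Subtype.ext ?_; simp
      map_mul' := fun a b => by refine LinearMap.ext fun x => Subtype.ext ?_; simp
      map_zero' := by refine LinearMap.ext fun x => Subtype.ext ?_; simp
      map_add' := fun a b => by refine LinearMap.ext fun x => Subtype.ext ?_; simp
      commutes' := fun c => by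
        refine LinearMap.ext fun x => Subtype.ext ?_
        simp [Module.algebraMap_end_apply] }

theorem sub_act_pow_coe {A : Type} [Ring A] [Algebra ℂ A] (M : FinMod.{u} A)
    (W : Submodule ℂ M.carrier) (h : M.IsInvariant W) (a : A) (k : ℕ) (x : W) :
    ((((M.sub W h).act a ^ k) x : W) : M.carrier) = (M.act a ^ k) x := by
  rw [← map_pow, ← map_pow]
  rfl

variable {D : RootDatum}

/-- `M` is isomorphic to `M_a^u`: it is generated by a vector `v` of weight `q ^ (2 a)` with
`E ^ u v ≠ 0` and `E ^ (u + 1) v = 0`. Linear independence of the `E ^ k v`, `k ≤ u`, is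
automatic. -/
def IsString (M : FinMod.{u} (UqPlus D)) (a u : ℕ) : Prop :=
  ∃ v : M.carrier, M.act (UqPlus.K D) v = (D.q ^ 2) ^ a • v ∧
    (M.act (UqPlus.E D) ^ (u + 1)) v = 0 ∧ (M.act (UqPlus.E D) ^ u) v ≠ 0 ∧
    Submodule.span ℂ (Set.range fun k : ℕ => (M.act (UqPlus.E D) ^ k) v) = ⊤

theorem act_K_E_pow (M : FinMod.{u} (UqPlus D)) (k : ℕ) (x : M.carrier) :
    M.act (UqPlus.K D) ((M.act (UqPlus.E D) ^ k) x) =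
      (D.q ^ 2) ^ k • (M.act (UqPlus.E D) ^ k) (M.act (UqPlus.K D) x) := by
  have h := mul_pow_qcomm (UqPlus.K_E D) k
  have h2 := LinearMap.congr_fun (congrArg M.act h) x
  simpa using h2

theorem IsString.lt_d {M : FinMod.{u} (UqPlus D)} {a u : ℕ} (h : M.IsString a u) : u < D.d := by
  obtain ⟨v, -, -, h, -⟩ := h
  by_contra! hu
  obtain ⟨r, rfl⟩ := Nat.exists_eq_add_of_le' hu
  exact h (by rw [pow_add, Module.End.mul_apply, act_E_pow_d]; simp)

theorem IsString.dim {M : FinMod.{u} (UqPlus D)} {a u : ℕ} (h : M.IsString a u) :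
    M.dim = u + 1 := by
  obtain ⟨v, -, h1, h2, h3⟩ := h
  rw [← span_range_string h1] at h3
  have b := Module.Basis.mk (string_linearIndependent h1 h2) h3.ge
  rw [FinMod.dim, Module.finrank_eq_card_basis b, Fintype.card_fin]

/-- If `E ^ u` does not vanish on a submodule `V`, then `V` has dimension at least `u + 1`; and
`E ^ u` cannot vanish on both summands of a decomposition. -/
theorem IsString.isIndecomposable {M : FinMod.{u} (UqPlus D)} {a u : ℕ} (h : M.IsString a u) :
    M.IsIndecomposable := by
  have hdim := h.dim
  obtain ⟨v, hv, h1, h2, h3⟩ := h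
  have hE : M.act (UqPlus.E D) ^ (u + 1) = 0 := by
    refine LinearMap.ext_on_range (v := fun k : ℕ => (M.act (UqPlus.E D) ^ k) v) h3 fun k => ?_
    rw [← Module.End.mul_apply, ← pow_add, add_comm, pow_add, Module.End.mul_apply, h1, map_zero,
      LinearMap.zero_apply]
  have big : ∀ V : Submodule ℂ M.carrier, M.IsInvariant V →
      (∃ x ∈ V, (M.act (UqPlus.E D) ^ u) x ≠ 0) → V = ⊤ := by
    rintro V hV ⟨x, hx, hxu⟩
    refine Submodule.eq_top_of_finrank_eq (le_antisymm (Submodule.finrank_le V) ?_)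
    have hli := string_linearIndependent (LinearMap.congr_fun hE x) hxu
    have hmem : ∀ k : ℕ, (M.act (UqPlus.E D) ^ k) x ∈ V := fun k => by
      rw [← map_pow]; exact hV _ x hx
    have hli' : LinearIndependent ℂ
        (fun k : Fin (u + 1) => (⟨(M.act (UqPlus.E D) ^ (k : ℕ)) x, hmem k⟩ : V)) :=
      LinearIndependent.of_comp V.subtype hli
    have := hli'.fintype_card_le_finrank
    rw [Fintype.card_fin] at this
    exact hdim.le.trans this
  refine ⟨⟨_, 0, h2⟩, fun V W hV hW hVW => ?_⟩
  by_cases hV' : ∃ x ∈ V, (M.act (UqPlus.E D) ^ u) x ≠ 0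
  · right
    have := hVW.disjoint
    rwa [big V hV hV', top_disjoint] at this
  by_cases hW' : ∃ x ∈ W, (M.act (UqPlus.E D) ^ u) x ≠ 0
  · left
    have := hVW.disjoint
    rwa [big W hW hW', disjoint_top] at this
  push Not at hV' hW'
  obtain ⟨x, hx, y, hy, hxy⟩ := Submodule.mem_sup.mp
    (hVW.sup_eq_top ▸ Submodule.mem_top : v ∈ V ⊔ W)
  exact absurd (by rw [← hxy, map_add, hV' x hx, hW' y hy, add_zero]) h2

/-- Every nonzero module has a direct summand that is a string: for `u` largest with `E ^ u ≠ 0`,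
a weight vector `v` with `E ^ u v ≠ 0` generates a summand, complementary to the largest submodule
in the kernel of a weight functional that does not vanish at `E ^ u v`. -/
theorem exists_string_summand (M : FinMod.{u} (UqPlus D)) [Nontrivial M.carrier] :
    ∃ (a u : ℕ) (v : M.carrier) (W : Submodule ℂ M.carrier),
      M.act (UqPlus.K D) v = (D.q ^ 2) ^ a • v ∧ (M.act (UqPlus.E D) ^ (u + 1)) v = 0 ∧
      (M.act (UqPlus.E D) ^ u) v ≠ 0 ∧ M.IsInvariant W ∧
      IsCompl (Submodule.span ℂ (Set.range fun k : ℕ => (M.act (UqPlus.E D) ^ k) v)) W := by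
  classical
  have hz := D.sq_prim
  set e := M.act (UqPlus.E D) with he
  set κ := M.act (UqPlus.K D) with hκ
  have hκd : κ ^ D.d = 1 := M.act_K_pow_d
  have hex : ∃ n, e ^ n = 0 := ⟨D.d, M.act_E_pow_d⟩
  obtain ⟨u, hu⟩ : ∃ u, Nat.find hex = u + 1 := by
    refine Nat.exists_eq_succ_of_ne_zero fun h => ?_
    have := Nat.find_spec hex
    rw [h, pow_zero] at this
    exact one_ne_zero this
  have hE : e ^ (u + 1) = 0 := hu ▸ Nat.find_spec hex
  have hEu : e ^ u ≠ 0 := Nat.find_min hex (by omega)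
  obtain ⟨a, ha⟩ : ∃ a, e ^ u * spectralProj (D.q ^ 2) D.d κ a ≠ 0 := by
    by_contra! h
    apply hEu
    rw [← mul_one (e ^ u), ← sum_spectralProj D.d_pos hz κ, Finset.mul_sum]
    exact Finset.sum_eq_zero fun a _ => h a
  obtain ⟨w, hw⟩ : ∃ w, (e ^ u * spectralProj (D.q ^ 2) D.d κ a) w ≠ 0 := by
    by_contra! h
    exact ha (LinearMap.ext h)
  set v := spectralProj (D.q ^ 2) D.d κ a w with hv
  have hKv : κ v = (D.q ^ 2) ^ a • v := LinearMap.congr_fun (mul_spectralProj D.d_pos hz hκd a) w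
  have hvu : (e ^ u) v ≠ 0 := hw
  obtain ⟨ψ, hψ⟩ : ∃ ψ : Module.Dual ℂ M.carrier, ψ ((e ^ u) v) ≠ 0 := by
    by_contra! h
    exact hvu ((Module.forall_dual_apply_eq_zero_iff ℂ _).mp h)
  have hKu : κ ((e ^ u) v) = (D.q ^ 2) ^ (u + a) • (e ^ u) v := by
    rw [hκ, he, act_K_E_pow, ← hκ, hKv, map_smul, smul_smul, pow_add]
  set φ : M.carrier →ₗ[ℂ] ℂ := ψ ∘ₗ spectralProj (D.q ^ 2) D.d κ (u + a) with hφ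
  have hφu : φ ((e ^ u) v) ≠ 0 := by
    rwa [hφ, LinearMap.comp_apply, spectralProj_apply_of_eigen D.d_pos hz hKu]
  have hφK : ∀ x, φ (κ x) = (D.q ^ 2) ^ (u + a) • φ x := fun x => by
    have h := (spectralProj_commute (z := D.q ^ 2) (d := D.d) (Commute.refl κ) (u + a)).eq
    rw [mul_spectralProj D.d_pos hz hκd] at h
    have h2 := congrArg ψ (LinearMap.congr_fun h x)
    simpa [hφ] using h2
  have hv1 : (e ^ (u + 1)) v = 0 := by rw [hE, LinearMap.zero_apply]
  have hinj := string_pairing_injective hv1 hφu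
  have hcompl := isCompl_range_ker ⟨hinj, LinearMap.injective_iff_surjective.mp hinj⟩
  rw [Fintype.range_linearCombination, span_range_string hv1] at hcompl
  refine ⟨a, u, v, _, hKv, hv1, hvu, isInvariant_of_generators ?_ ?_, hcompl⟩
  · intro x hx
    rw [LinearMap.mem_ker] at hx ⊢
    funext k
    change φ ((e ^ (k : ℕ)) (e x)) = 0
    rw [← Module.End.mul_apply, ← pow_succ]
    by_cases hk : (k : ℕ) + 1 < u + 1
    · exact congrFun hx ⟨k + 1, hk⟩
    · have : (k : ℕ) + 1 = u + 1 := by omega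
      rw [this, hE, LinearMap.zero_apply, map_zero]
  · intro x hx
    rw [LinearMap.mem_ker] at hx ⊢
    funext k
    change φ ((e ^ (k : ℕ)) (κ x)) = 0
    have h1 := congrArg φ (M.act_K_E_pow k x)
    have h2 : φ ((e ^ (k : ℕ)) x) = 0 := congrFun hx k
    rw [← hκ, ← he, hφK, h2, smul_zero, map_smul] at h1
    exact (smul_eq_zero.mp h1.symm).resolve_left (pow_ne_zero _ D.q_sq_ne_zero)

theorem isInvariant_span_string {M : FinMod.{u} (UqPlus D)} {v : M.carrier} {a : ℕ}
    (hv : M.act (UqPlus.K D) v = (D.q ^ 2) ^ a • v) : M.IsInvariant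
      (Submodule.span ℂ (Set.range fun k : ℕ => (M.act (UqPlus.E D) ^ k) v)) := by
  refine isInvariant_of_generators (fun x hx => ?_) (fun x hx => ?_)
  · induction hx using Submodule.span_induction with
    | mem x h =>
      obtain ⟨k, rfl⟩ := h
      refine Submodule.subset_span ⟨k + 1, ?_⟩
      simp only [pow_succ', Module.End.mul_apply]
    | zero => rw [map_zero]; exact Submodule.zero_mem _
    | add x y _ _ hx hy => rw [map_add]; exact Submodule.add_mem _ hx hy
    | smul c x _ hx => rw [map_smul]; exact Submodule.smul_mem _ _ hx
  · induction hx using Submodule.span_induction with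
    | mem x h =>
      obtain ⟨k, rfl⟩ := h
      simp only
      rw [act_K_E_pow, hv, map_smul]
      exact Submodule.smul_mem _ _ (Submodule.smul_mem _ _ (Submodule.subset_span ⟨k, rfl⟩))
    | zero => rw [map_zero]; exact Submodule.zero_mem _
    | add x y _ _ hx hy => rw [map_add]; exact Submodule.add_mem _ hx hy
    | smul c x _ hx => rw [map_smul]; exact Submodule.smul_mem _ _ hx

theorem IsIndecomposable.exists_isString {M : FinMod.{u} (UqPlus D)} (h : M.IsIndecomposable) :
    ∃ a u, M.IsString a u := by
  have := h.1
  obtain ⟨a, u, v, W, h1, h2, h3, h4, h5⟩ := exists_string_summand M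
  refine ⟨a, u, v, h1, h2, h3, ?_⟩
  rcases h.2 _ _ (isInvariant_span_string h1) h4 h5 with h6 | h6
  · refine absurd ?_ h3
    rw [← Submodule.mem_bot ℂ, ← h6]
    exact Submodule.subset_span ⟨u, rfl⟩
  · simpa [h6] using h5.sup_eq_top

theorem isString_span {M : FinMod.{u} (UqPlus D)} {v : M.carrier} {a u : ℕ}
    (hv : M.act (UqPlus.K D) v = (D.q ^ 2) ^ a • v)
    (h1 : (M.act (UqPlus.E D) ^ (u + 1)) v = 0) (h2 : (M.act (UqPlus.E D) ^ u) v ≠ 0) :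
    (M.sub _ (isInvariant_span_string hv)).IsString a u := by
  refine ⟨⟨v, Submodule.subset_span ⟨0, by simp⟩⟩, Subtype.ext hv, Subtype.ext ?_,
    fun h => h2 ?_, ?_⟩
  · rw [sub_act_pow_coe]; exact h1
  · exact (sub_act_pow_coe M _ (isInvariant_span_string hv) (UqPlus.E D) u _).symm.trans
      (congrArg Subtype.val h)
  · refine Submodule.map_injective_of_injective
      (Submodule.subtype_injective
        (Submodule.span ℂ (Set.range fun k : ℕ => (M.act (UqPlus.E D) ^ k) v))) ?_
    rw [Submodule.map_span, Submodule.map_top, Submodule.range_subtype, ← Set.range_comp]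
    congr 2
    funext k
    exact sub_act_pow_coe M _ (isInvariant_span_string hv) _ _ _

theorem IsString.of_iso {M N : FinMod.{u} (UqPlus D)} {a u : ℕ} (h : M.IsString a u)
    (f : Iso M N) : N.IsString a u := by
  obtain ⟨v, hv, h1, h2, h3⟩ := h
  have hk : ∀ k, (N.act (UqPlus.E D) ^ k) (f.equiv v) = f.equiv ((M.act (UqPlus.E D) ^ k) v) :=
    fun k => by rw [← map_pow, ← map_pow, f.map_act]
  refine ⟨f.equiv v, ?_, ?_, ?_, ?_⟩
  · rw [← f.map_act, hv, map_smul]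
  · rw [hk, h1, map_zero]
  · rwa [hk, Ne, LinearEquiv.map_eq_zero_iff]
  · simp only [hk]
    have := congrArg (Submodule.map f.equiv.toLinearMap) h3
    rw [Submodule.map_span, ← Set.range_comp, Submodule.map_top, LinearEquiv.range] at this
    exact this

/-- A simple module is one-dimensional; `E` acts on it by `0`. -/
theorem IsSimple.isString {S : FinMod.{u} (UqPlus D)} (h : S.IsSimple) : ∃ a, S.IsString a 0 := by
  have hind : S.IsIndecomposable := ⟨h.1, fun V W hV hW hVW => by
    rcases h.2 V hV with h1 | h1
    · exact Or.inl h1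
    · right
      have := hVW.disjoint
      rwa [h1, top_disjoint] at this⟩
  obtain ⟨a, u, hs⟩ := hind.exists_isString
  obtain rfl | hu := Nat.eq_zero_or_pos u
  · exact ⟨a, hs⟩
  exfalso
  obtain ⟨v, hv, h1, h2, h3⟩ := hs
  have hker : S.IsInvariant (LinearMap.ker (S.act (UqPlus.E D))) := by
    refine isInvariant_of_generators (fun x hx => ?_) fun x hx => ?_
    · rw [LinearMap.mem_ker.mp hx]; exact Submodule.zero_mem _
    · rw [LinearMap.mem_ker] at hx ⊢
      have := S.act_K_E x
      rw [hx, map_zero] at this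
      exact (smul_eq_zero.mp this.symm).resolve_left D.q_sq_ne_zero
  have hmem : (S.act (UqPlus.E D) ^ u) v ∈ LinearMap.ker (S.act (UqPlus.E D)) := by
    rw [LinearMap.mem_ker, ← Module.End.mul_apply, ← pow_succ', h1]
  rcases h.2 _ hker with h4 | h4
  · rw [h4, Submodule.mem_bot] at hmem
    exact h2 hmem
  · apply h2
    obtain ⟨r, rfl⟩ := Nat.exists_eq_add_of_le' hu
    rw [LinearMap.ker_eq_top.mp h4]
    simp

theorem IsString.isSimple {S : FinMod.{u} (UqPlus D)} {a : ℕ} (h : S.IsString a 0) :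
    S.IsSimple := by
  have hd := h.dim
  refine ⟨h.isIndecomposable.1, fun W _ => ?_⟩
  have hW := Submodule.finrank_le W
  change _ ≤ S.dim at hW
  rw [hd] at hW
  rcases Nat.le_one_iff_eq_zero_or_eq_one.mp hW with h0 | h1
  · exact Or.inl (Submodule.finrank_eq_zero.mp h0)
  · exact Or.inr (Submodule.eq_top_of_finrank_eq (h1.trans hd.symm))

/-- `S ⊗ M_b^u ≅ M_{a+b}^u` for the simple module `S` of weight `q ^ (2 a)`. -/
theorem IsString.tensor {S X : FinMod.{u} (UqPlus D)} {a b u : ℕ} (hS : S.IsString a 0)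
    (hX : X.IsString b u) : (S.tensor X).IsString (a + b) u := by
  obtain ⟨s, hs, hs1, hs0, hs3⟩ := hS
  obtain ⟨v, hv, h1, h2, h3⟩ := hX
  rw [zero_add, pow_one] at hs1
  rw [pow_zero, Module.End.one_apply] at hs0
  have hk : ∀ k, ((S.tensor X).act (UqPlus.E D) ^ k) (s ⊗ₜ[ℂ] v) =
      s ⊗ₜ[ℂ] (X.act (UqPlus.E D) ^ k) v := fun k => by
    induction k with
    | zero => simp
    | succ k ih =>
      rw [pow_succ', Module.End.mul_apply, ih, tensor_act_E, hs1, TensorProduct.zero_tmul,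
        add_zero, pow_succ', Module.End.mul_apply]
  refine ⟨s ⊗ₜ[ℂ] v, ?_, ?_, ?_, ?_⟩
  · rw [tensor_act_K, hs, hv, ← TensorProduct.smul_tmul', TensorProduct.tmul_smul, smul_smul,
      pow_add]
  · rw [hk, h1, TensorProduct.tmul_zero]
  · rw [hk]
    exact tmul_ne_zero hs0 h2
  · simp only [hk]
    rw [eq_top_iff, ← TensorProduct.span_tmul_eq_top, Submodule.span_le]
    rintro _ ⟨t, x, rfl⟩
    have ht : t ∈ Submodule.span ℂ {s} := by
      refine (Submodule.span_le.mpr ?_ : _ ≤ _) (hs3 ▸ Submodule.mem_top : t ∈ _)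
      rintro _ ⟨k, rfl⟩
      cases k with
      | zero => exact Submodule.mem_span_singleton_self s
      | succ k =>
        simp only [pow_succ, Module.End.mul_apply, hs1, map_zero]
        exact Submodule.zero_mem _
    obtain ⟨c, rfl⟩ := Submodule.mem_span_singleton.mp ht
    rw [TensorProduct.smul_tmul]
    have hx : c • x ∈ Submodule.span ℂ (Set.range fun k : ℕ => (X.act (UqPlus.E D) ^ k) v) :=
      h3 ▸ Submodule.mem_top
    have := Submodule.mem_map_of_mem (f := TensorProduct.mk ℂ S.carrier X.carrier s) hx
    rw [Submodule.map_span, ← Set.range_comp] at this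
    exact this

/-! ### Decomposition into indecomposables -/

/-- A module with complementary submodules `C`, `W`, with `C ≅ P 0` and `W` the direct sum of the
other `P i`, is the direct sum of the `P i`. -/
noncomputable def Iso.directSumSucc {A : Type} [Ring A] [Algebra ℂ A] {r : ℕ}
    {M : FinMod.{u} A} (P : Fin (r + 1) → FinMod.{u} A) {C W : Submodule ℂ M.carrier}
    (hC : M.IsInvariant C) (hW : M.IsInvariant W) (h : IsCompl C W)
    (f : Iso (P 0) (M.sub C hC)) (g : Iso (directSum fun i => P i.succ) (M.sub W hW)) :
    Iso (directSum P) M where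
  equiv := (Fin.consLinearEquiv ℂ fun i => (P i).carrier).symm.trans <|
    (LinearEquiv.prodCongr f.equiv g.equiv).trans (Submodule.prodEquivOfIsCompl C W h)
  map_act a x := by
    have h1 : ∀ y : (directSum P).carrier,
        ((Fin.consLinearEquiv ℂ fun i => (P i).carrier).symm.trans <|
          (LinearEquiv.prodCongr f.equiv g.equiv).trans (Submodule.prodEquivOfIsCompl C W h)) y =
        (f.equiv (y 0) : M.carrier) + (g.equiv (fun i => y i.succ) : M.carrier) := fun y => rfl
    rw [h1, h1, map_add]
    exact congrArg₂ (· + ·) (congrArg Subtype.val (f.map_act a (x 0)))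
      (congrArg Subtype.val (g.map_act a fun i => x i.succ))

/-- Splitting off string summands one after the other. -/
theorem exists_decomposition (M : FinMod.{u} (UqPlus D)) :
    ∃ (r : ℕ) (P : Fin r → FinMod.{u} (UqPlus D)), (∀ i, (P i).IsIndecomposable) ∧
      Nonempty (Iso (directSum P) M) := by
  induction hn : M.dim using Nat.strong_induction_on generalizing M with
  | _ n ih =>
    rcases subsingleton_or_nontrivial M.carrier with h | h
    · refine ⟨0, Fin.elim0, fun i => i.elim0, ⟨⟨0, fun a x => Subsingleton.elim _ _⟩⟩⟩
    · obtain ⟨a, u, v, W, hv, h1, h2, hW, hc⟩ := exists_string_summand M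
      have hs := isString_span hv h1 h2
      have hdim : (M.sub W hW).dim < n := by
        have h3 := Submodule.finrank_add_eq_of_isCompl hc
        have h4 := hs.dim
        change Module.finrank ℂ _ = _ at h4
        rw [h4] at h3
        have h5 : (M.sub W hW).dim = Module.finrank ℂ W := rfl
        have h6 : M.dim = Module.finrank ℂ M.carrier := rfl
        omega
      obtain ⟨r, P, hP, ⟨g⟩⟩ := ih _ hdim (M.sub W hW) rfl
      refine ⟨r + 1, Fin.cons (M.sub _ (isInvariant_span_string hv)) P, ?_,
        ⟨Iso.directSumSucc _ (isInvariant_span_string hv) hW hc (Iso.refl _) g⟩⟩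
      intro i
      induction i using Fin.cases with
      | zero => exact hs.isIndecomposable
      | succ i => exact hP i

end FinMod

/-! ### Extending the action on a string to `u_q` -/

theorem Uq.exists_algHom {D : RootDatum} {A : Type*} [Ring A] [Algebra ℂ A] {e f k : A}
    (he : e ^ D.d = 0) (hf : f ^ D.d = 0) (hk : k ^ D.d = 1) (hke : k * e = D.q ^ 2 • (e * k))
    (hkf : k * f = (D.q ^ 2)⁻¹ • (f * k))
    (hef : e * f - f * e = (D.q - D.q⁻¹)⁻¹ • (k - k ^ (D.d - 1))) :
    ∃ φ : Uq D →ₐ[ℂ] A, φ (Uq.E D) = e ∧ φ (Uq.K D) = k := by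
  let g : Gen → A := fun x => match x with
    | Gen.E => e
    | Gen.F => f
    | Gen.K => k
  have hg : ∀ ⦃x y : FreeAlgebra ℂ Gen⦄, Rel D x y →
      FreeAlgebra.lift ℂ g x = FreeAlgebra.lift ℂ g y := by
    intro x y h
    induction h <;> simpa [g, FreeAlgebra.lift_ι_apply]
  refine ⟨RingQuot.liftAlgHom ℂ ⟨FreeAlgebra.lift ℂ g, hg⟩, ?_, ?_⟩
  · exact (RingQuot.liftAlgHom_mkAlgHom_apply ℂ _ hg _).trans (FreeAlgebra.lift_ι_apply _ _)
  · exact (RingQuot.liftAlgHom_mkAlgHom_apply ℂ _ hg _).trans (FreeAlgebra.lift_ι_apply _ _)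

/-- A string of length `u + 1` with lowest weight `q ^ (2 j)` extends to `u_q` as soon as the sum of
the scalars by which `K - K⁻¹` acts along the string vanishes: `F` sends each vector of the string
to a multiple of the preceding one, and `E F - F E = (K - K⁻¹) / (q - q⁻¹)` determines the multiples
recursively, the vanishing sum being the condition at the end of the string. -/
theorem exists_uq_action (D : RootDatum) {V : Type*} [AddCommGroup V] [Module ℂ V]
    {e k : Module.End ℂ V} {v : V} {j u : ℕ} (hud : u < D.d) (hv : k v = (D.q ^ 2) ^ j • v)
    (hke : k * e = D.q ^ 2 • (e * k)) (h1 : (e ^ (u + 1)) v = 0) (h2 : (e ^ u) v ≠ 0)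
    (h3 : Submodule.span ℂ (Set.range fun m : ℕ => (e ^ m) v) = ⊤)
    (hsum : ∑ m ∈ Finset.range (u + 1), ((D.q ^ 2) ^ (j + m) - (D.q ^ 2)⁻¹ ^ (j + m)) = 0) :
    ∃ act : Uq D →ₐ[ℂ] Module.End ℂ V, act (Uq.E D) = e ∧ act (Uq.K D) = k := by
  have hq2 := D.q_sq_ne_zero
  have hvan : ∀ m, u < m → (e ^ m) v = 0 := fun m hm => pow_apply_eq_zero_of_lt h1 hm
  have hkm : ∀ m, k ((e ^ m) v) = (D.q ^ 2) ^ (j + m) • (e ^ m) v := fun m => by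
    rw [← Module.End.mul_apply, mul_pow_qcomm hke, LinearMap.smul_apply, Module.End.mul_apply, hv,
      map_smul, smul_smul, add_comm, pow_add]
  have hem : ∀ m, e ((e ^ m) v) = (e ^ (m + 1)) v := fun m => by
    rw [pow_succ', Module.End.mul_apply]
  have h3' := h3
  rw [← span_range_string h1] at h3'
  let b := Module.Basis.mk (string_linearIndependent h1 h2) h3'.ge
  -- `F E ^ m v = c m • E ^ (m - 1) v`, where `c 0 = 0` makes the junk value `E ^ (0 - 1) v`
  -- irrelevant and `c (u + 1) = 0` makes the formula valid beyond the end of the string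
  let c : ℕ → ℂ := fun m => -((D.q - D.q⁻¹)⁻¹ *
    ∑ l ∈ Finset.range m, ((D.q ^ 2) ^ (j + l) - (D.q ^ 2)⁻¹ ^ (j + l)))
  have c0 : c 0 = 0 := by simp [c]
  have cu : c (u + 1) = 0 := by simp only [c]; rw [hsum, mul_zero, neg_zero]
  have cs : ∀ m, c m - c (m + 1) =
      (D.q - D.q⁻¹)⁻¹ * ((D.q ^ 2) ^ (j + m) - (D.q ^ 2)⁻¹ ^ (j + m)) := fun m => by
    simp only [c, Finset.sum_range_succ]; ring
  let f : Module.End ℂ V := b.constr ℂ fun m => c m • (e ^ ((m : ℕ) - 1)) v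
  have hfm : ∀ m, f ((e ^ m) v) = c m • (e ^ (m - 1)) v := by
    intro m
    by_cases hm : m < u + 1
    · have hb : b ⟨m, hm⟩ = (e ^ m) v := by simp [b]
      rw [← hb]
      exact b.constr_basis ℂ _ _
    · rw [hvan m (by omega), map_zero]
      obtain rfl | hm' := eq_or_lt_of_le (not_lt.mp hm)
      · rw [cu, zero_smul]
      · rw [hvan (m - 1) (by omega), smul_zero]
  have hkpow : ∀ i m, (k ^ i) ((e ^ m) v) = ((D.q ^ 2) ^ (j + m)) ^ i • (e ^ m) v := by
    intro i m
    induction i with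
    | zero => simp
    | succ i ih => rw [pow_succ', Module.End.mul_apply, ih, map_smul, hkm, smul_smul, ← pow_succ]
  have hwd : ∀ m, ((D.q ^ 2) ^ (j + m)) ^ D.d = 1 := fun m => by
    rw [← pow_mul, mul_comm, pow_mul, D.sq_prim.pow_eq_one, one_pow]
  have hext : ∀ g h : Module.End ℂ V, (∀ m : ℕ, g ((e ^ m) v) = h ((e ^ m) v)) → g = h :=
    fun g h => LinearMap.ext_on_range (v := fun m : ℕ => (e ^ m) v) h3
  refine Uq.exists_algHom (f := f) (hext _ _ fun m => ?_) (hext _ _ fun m => ?_)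
    (hext _ _ fun m => ?_) hke (hext _ _ fun m => ?_) (hext _ _ fun m => ?_)
  · rw [← Module.End.mul_apply, ← pow_add, hvan _ (by omega), LinearMap.zero_apply]
  · have hfpow : ∀ l, (f ^ (l + 1)) ((e ^ l) v) = 0 := by
      intro l
      induction l with
      | zero => rw [pow_one, hfm, c0, zero_smul]
      | succ l ih => rw [pow_succ, Module.End.mul_apply, hfm, map_smul, Nat.add_sub_cancel, ih,
          smul_zero]
    rw [LinearMap.zero_apply]
    by_cases hm : m < u + 1
    · obtain ⟨r, hr⟩ := Nat.exists_eq_add_of_le' (show m + 1 ≤ D.d by omega)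
      rw [hr, pow_add, Module.End.mul_apply, hfpow, map_zero]
    · rw [hvan m (by omega), map_zero]
  · rw [hkpow, hwd, one_smul, Module.End.one_apply]
  · rw [Module.End.mul_apply, LinearMap.smul_apply, Module.End.mul_apply, hfm, map_smul, hkm, hkm,
      map_smul, hfm]
    cases m with
    | zero => rw [c0]; simp
    | succ m =>
      rw [Nat.add_sub_cancel, smul_smul, smul_smul, smul_smul]
      congr 1
      rw [← add_assoc j, pow_succ (D.q ^ 2) (j + m)]
      linear_combination -(c (m + 1) * (D.q ^ 2) ^ (j + m)) * mul_inv_cancel₀ hq2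
  · rw [LinearMap.sub_apply, Module.End.mul_apply, Module.End.mul_apply, hem, hfm, hfm, map_smul,
      hem, Nat.add_sub_cancel]
    have h4 : c m • (e ^ (m - 1 + 1)) v = c m • (e ^ m) v := by
      cases m with
      | zero => rw [c0, zero_smul, zero_smul]
      | succ m => rfl
    have h5 : ((D.q ^ 2) ^ (j + m)) ^ (D.d - 1) = (D.q ^ 2)⁻¹ ^ (j + m) := by
      rw [inv_pow]
      refine eq_inv_of_mul_eq_one_left ?_
      rw [← pow_succ, Nat.sub_add_cancel D.d_pos, hwd]
    rw [h4, ← sub_smul, cs, LinearMap.smul_apply, LinearMap.sub_apply, hkm, hkpow, h5, mul_smul,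
      sub_smul]

/-! ### The characters of `u_q⁺` -/

/-- `u_q⁺` is defined as a subalgebra, without a presentation; its characters come from common
eigenvectors of `E` and `K`. -/
theorem UqPlus.exists_character_of_eigenvector {D : RootDatum} {V : Type*} [AddCommGroup V]
    [Module ℂ V] (act : UqPlus D →ₐ[ℂ] Module.End ℂ V) {w : V} {c : ℂ} (hw : w ≠ 0)
    (hE : act (UqPlus.E D) w = 0) (hK : act (UqPlus.K D) w = c • w) :
    ∃ χ : UqPlus D →ₐ[ℂ] ℂ, χ (UqPlus.E D) = 0 ∧ χ (UqPlus.K D) = c := by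
  have hex : ∀ a, ∃ t : ℂ, act a w = t • w := fun a => by
    induction a using UqPlus.induction with
    | hE => exact ⟨0, by rw [hE, zero_smul]⟩
    | hK => exact ⟨c, hK⟩
    | halg t => exact ⟨t, by simp [Module.algebraMap_end_apply]⟩
    | hadd a b ha hb =>
      obtain ⟨s, hs⟩ := ha
      obtain ⟨t, ht⟩ := hb
      exact ⟨s + t, by rw [map_add, LinearMap.add_apply, hs, ht, add_smul]⟩
    | hmul a b ha hb =>
      obtain ⟨s, hs⟩ := ha
      obtain ⟨t, ht⟩ := hb
      exact ⟨t * s, by rw [map_mul, Module.End.mul_apply, ht, map_smul, hs, smul_smul]⟩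
  choose χ hχ using hex
  have huniq : ∀ a t, act a w = t • w → χ a = t := fun a t h =>
    smul_left_injective ℂ hw ((hχ a).symm.trans h)
  refine ⟨⟨⟨⟨⟨χ, ?_⟩, ?_⟩, ?_, ?_⟩, ?_⟩, ?_, ?_⟩
  · exact huniq _ _ (by simp)
  · intro a b
    exact huniq _ _ (by
      rw [map_mul, Module.End.mul_apply, hχ b, map_smul, hχ a, smul_smul, mul_comm])
  · exact huniq _ _ (by simp)
  · intro a b
    exact huniq _ _ (by rw [map_add, LinearMap.add_apply, hχ a, hχ b, add_smul])
  · intro t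
    exact huniq _ _ (by simp [Module.algebraMap_end_apply])
  · exact huniq _ _ (by rw [hE, zero_smul])
  · exact huniq _ _ hK

/-- The character of `u_q⁺` with `E ↦ 0`, `K ↦ q ^ (2 a)`. It is found on the highest weight line of
a string of length `d`, which extends to `u_q` for every lowest weight, so that `u_q⁺`, defined
inside `u_q`, acts on it. -/
theorem UqPlus.exists_character (D : RootDatum) (a : ℕ) :
    ∃ χ : UqPlus D →ₐ[ℂ] ℂ, χ (UqPlus.E D) = 0 ∧ χ (UqPlus.K D) = (D.q ^ 2) ^ a := by
  have hd := D.d_pos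
  let b := Pi.basisFun ℂ (Fin D.d)
  let y : ℕ → Fin D.d → ℂ := fun m => if h : m < D.d then b ⟨m, h⟩ else 0
  have hy0 : ∀ m, D.d ≤ m → y m = 0 := fun m hm => dif_neg (not_lt.mpr hm)
  have hyb : ∀ m : Fin D.d, y m = b m := fun m => dif_pos m.2
  let e : Module.End ℂ (Fin D.d → ℂ) := b.constr ℂ fun m => y (m + 1)
  let k : Module.End ℂ (Fin D.d → ℂ) := b.constr ℂ fun m => (D.q ^ 2) ^ (a + 1 + m) • y m
  have he : ∀ m, e (y m) = y (m + 1) := fun m => by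
    by_cases hm : m < D.d
    · rw [show y m = b ⟨m, hm⟩ from dif_pos hm]
      exact b.constr_basis ℂ _ _
    · rw [hy0 m (by omega), hy0 (m + 1) (by omega), map_zero]
  have hk : ∀ m, k (y m) = (D.q ^ 2) ^ (a + 1 + m) • y m := fun m => by
    by_cases hm : m < D.d
    · nth_rewrite 1 [show y m = b ⟨m, hm⟩ from dif_pos hm]
      exact b.constr_basis ℂ _ _
    · rw [hy0 m (by omega), map_zero, smul_zero]
  have hpow : ∀ m, (e ^ m) (y 0) = y m := fun m => by
    induction m with
    | zero => rfl
    | succ m ih => rw [pow_succ', Module.End.mul_apply, ih, he]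
  have hne : y (D.d - 1) ≠ 0 := by
    have h := hyb ⟨D.d - 1, by omega⟩
    exact h ▸ b.ne_zero _
  have hspan : Submodule.span ℂ (Set.range fun m : ℕ => (e ^ m) (y 0)) = ⊤ := by
    rw [eq_top_iff, ← b.span_eq, Submodule.span_le]
    rintro _ ⟨m, rfl⟩
    exact Submodule.subset_span ⟨m, (hpow m).trans (hyb m)⟩
  have hsd : D.d - 1 + 1 = D.d := Nat.sub_add_cancel hd
  have hsum0 : ∀ z : ℂ, IsPrimitiveRoot z D.d → ∑ m ∈ Finset.range D.d, z ^ (a + 1 + m) = 0 :=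
    fun z hz => by
      simp only [pow_add z (a + 1)]
      rw [← Finset.mul_sum, sum_pow_eq_zero hz.pow_eq_one
        (hz.ne_one (by have := D.two_lt_d; omega)),
        mul_zero]
  obtain ⟨act, hactE, hactK⟩ := exists_uq_action D (e := e) (k := k) (v := y 0) (j := a + 1)
    -- lowest weight `q ^ (2 (a + 1))`, so that the highest weight is `q ^ (2 (a + d)) = q ^ (2 a)`
    (u := D.d - 1) (by omega) (hk 0)
    (b.ext fun m => by
      rw [← hyb, Module.End.mul_apply, LinearMap.smul_apply, Module.End.mul_apply, he, hk, hk,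
        map_smul, he, smul_smul, ← pow_succ']
      rfl)
    (by rw [hpow, hy0 _ (by omega)]) (by rwa [hpow]) hspan
    (by rw [hsd, Finset.sum_sub_distrib, hsum0 _ D.sq_prim, hsum0 _ D.sq_prim.inv, sub_zero])
  refine UqPlus.exists_character_of_eigenvector (act.comp (UqPlus D).val) hne ?_ ?_
  · change act (Uq.E D) _ = 0
    rw [hactE, he, hy0 _ (by omega)]
  · change act (Uq.K D) _ = _
    rw [hactK, hk, add_assoc, add_comm 1, hsd, pow_add, D.sq_prim.pow_eq_one, mul_one]

namespace FinMod

variable {D : RootDatum}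

variable (D) in
theorem exists_isString_zero (a : ℕ) : ∃ S : FinMod.{u} (UqPlus D), S.IsString a 0 := by
  obtain ⟨χ, hE, hK⟩ := UqPlus.exists_character D a
  refine ⟨⟨ULift.{u} ℂ, (Algebra.ofId ℂ _).comp χ⟩, ULift.up 1, ?_, ?_, ?_, ?_⟩
  · change algebraMap ℂ (Module.End ℂ (ULift.{u} ℂ)) (χ (UqPlus.K D)) _ = _
    rw [hK, Module.algebraMap_end_apply]
  · simp [hE]
  · intro h
    exact one_ne_zero (congrArg ULift.down h)
  · rw [eq_top_iff]
    rintro ⟨x⟩ -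
    have h : (ULift.up x : ULift.{u} ℂ) = x • ULift.up 1 := by
      refine ULift.ext _ _ ?_; simp
    rw [h]
    exact Submodule.smul_mem _ _ (Submodule.subset_span ⟨0, by simp⟩)

/-- Strings with the same lowest weight and the same length are isomorphic. -/
theorem IsString.nonempty_iso {M N : FinMod.{u} (UqPlus D)} {a b u : ℕ} (hM : M.IsString a u)
    (hN : N.IsString b u) (hab : (D.q ^ 2) ^ a = (D.q ^ 2) ^ b) : Nonempty (Iso M N) := by
  obtain ⟨v, hv, h1, h2, h3⟩ := hM
  obtain ⟨w, hw, g1, g2, g3⟩ := hN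
  have h3' := h3
  have g3' := g3
  rw [← span_range_string h1] at h3'
  rw [← span_range_string g1] at g3'
  let b1 := Module.Basis.mk (string_linearIndependent h1 h2) h3'.ge
  let b2 := Module.Basis.mk (string_linearIndependent g1 g2) g3'.ge
  let f := b1.equiv b2 (Equiv.refl _)
  have hf : ∀ m, f ((M.act (UqPlus.E D) ^ m) v) = (N.act (UqPlus.E D) ^ m) w := fun m => by
    by_cases hm : m < u + 1
    · have e1 : b1 ⟨m, hm⟩ = (M.act (UqPlus.E D) ^ m) v := by simp [b1]
      have e2 : b2 ⟨m, hm⟩ = (N.act (UqPlus.E D) ^ m) w := by simp [b2]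
      rw [← e1, ← e2]
      exact b1.equiv_apply _ _ _
    · rw [pow_apply_eq_zero_of_lt h1 (by omega), pow_apply_eq_zero_of_lt g1 (by omega), map_zero]
  refine ⟨Iso.ofGenerators f (LinearMap.ext_on_range h3 fun m => ?_)
    (LinearMap.ext_on_range h3 fun m => ?_)⟩
  · rw [LinearMap.comp_apply, LinearMap.comp_apply, LinearEquiv.coe_coe, hf,
      ← Module.End.mul_apply, ← pow_succ', hf, pow_succ', Module.End.mul_apply]
  · rw [LinearMap.comp_apply, LinearMap.comp_apply, LinearEquiv.coe_coe, hf, act_K_E_pow,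
      act_K_E_pow, hv, hw, map_smul, map_smul, map_smul, map_smul, hf, hab]

/-- If `2 j + u = 0` modulo `d` for some `j`, then the string `M_j^u` extends to `u_q`: its weights
are symmetric under inversion. All strings of length `u + 1` are tensor products of it with simple
modules. -/
theorem IsString.exists_iso_tensor {M : FinMod.{u} (UqPlus D)} {a u : ℕ} (h : M.IsString a u)
    (hj : ∃ j, D.d ∣ 2 * j + u) :
    ∃ (S : FinMod.{u} (UqPlus D)) (b : ℕ) (X : FinMod.{u} (Uq D)) (j : ℕ), S.IsString b 0 ∧
      X.restrict.IsString j u ∧ Nonempty (Iso M (S.tensor X.restrict)) := by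
  obtain ⟨j, t, ht⟩ := hj
  have hz := D.sq_prim
  have hq2 := D.q_sq_ne_zero
  have hud := h.lt_d
  have hM := h
  obtain ⟨v, hv, h1, h2, h3⟩ := h
  -- the weights at the positions `m` and `u - m` of `M_j^u` are inverse to each other
  have hlast : ∀ m ≤ u, (D.q ^ 2)⁻¹ ^ (j + (u - m)) = (D.q ^ 2) ^ (j + m) := fun m hm => by
    rw [inv_pow]
    refine inv_eq_of_mul_eq_one_right ?_
    rw [← pow_add, show j + (u - m) + (j + m) = D.d * t by omega, pow_mul, hz.pow_eq_one, one_pow]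
  obtain ⟨act, hactE, hactK⟩ := exists_uq_action D (e := M.act (UqPlus.E D))
    (k := ((D.q ^ 2)⁻¹ ^ a * (D.q ^ 2) ^ j) • M.act (UqPlus.K D)) (v := v) (j := j) hud
    (by
      rw [LinearMap.smul_apply, hv, smul_smul, inv_pow, mul_right_comm,
        inv_mul_cancel₀ (pow_ne_zero _ hq2), one_mul])
    (by
      rw [smul_mul_assoc, mul_smul_comm, ← map_mul, ← map_mul, UqPlus.K_E, map_smul, smul_comm])
    h1 h2 h3
    (by
      rw [Finset.sum_sub_distrib, sub_eq_zero,
        ← Finset.sum_range_reflect fun m => (D.q ^ 2)⁻¹ ^ (j + m)]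
      refine Finset.sum_congr rfl fun m hm => ?_
      rw [Nat.add_sub_cancel, hlast m (by have := Finset.mem_range.mp hm; omega)])
  -- natural number exponents: `(d - 1) j` stands for `-j` modulo `d`
  obtain ⟨S, hS⟩ := exists_isString_zero.{u} D (a + (D.d - 1) * j)
  let X : FinMod.{u} (Uq D) := ⟨M.carrier, act⟩
  have hXE : X.restrict.act (UqPlus.E D) = M.act (UqPlus.E D) := hactE
  have hXK : X.restrict.act (UqPlus.K D) =
    ((D.q ^ 2)⁻¹ ^ a * (D.q ^ 2) ^ j) • M.act (UqPlus.K D) := hactK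
  have hX : X.restrict.IsString j u := by
    refine ⟨v, ?_, by rwa [hXE], by rwa [hXE], by rwa [hXE]⟩
    rw [hXK, LinearMap.smul_apply, hv, smul_smul, inv_pow, mul_right_comm,
        inv_mul_cancel₀ (pow_ne_zero _ hq2), one_mul]
  refine ⟨S, _, X, j, hS, hX, hM.nonempty_iso (hS.tensor hX) ?_⟩
  have : (D.d - 1) * j + j = D.d * j := by
    rw [← Nat.succ_mul, Nat.succ_eq_add_one, Nat.sub_add_cancel D.d_pos]
  rw [add_assoc, this, pow_add, pow_mul _ D.d, hz.pow_eq_one, one_pow, mul_one]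

/-! ### Isomorphisms given by the `R`-matrix -/

theorem IsString.act_E_of_zero {S : FinMod.{u} (UqPlus D)} {a : ℕ} (h : S.IsString a 0)
    (s : S.carrier) : S.act (UqPlus.E D) s = 0 := by
  obtain ⟨v, -, h1, -, h3⟩ := h
  have : S.act (UqPlus.E D) = 0 := LinearMap.ext_on_range h3 fun k => by
    rw [← Module.End.mul_apply, ← pow_succ', pow_succ, Module.End.mul_apply]
    rw [zero_add, pow_one] at h1
    rw [h1, map_zero, LinearMap.zero_apply]
  rw [this, LinearMap.zero_apply]

theorem IsString.act_K_of_zero {S : FinMod.{u} (UqPlus D)} {a : ℕ} (h : S.IsString a 0)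
    (s : S.carrier) : S.act (UqPlus.K D) s = (D.q ^ 2) ^ a • s := by
  have hE := h.act_E_of_zero
  obtain ⟨v, hv, -, -, h3⟩ := h
  have : S.act (UqPlus.K D) = (D.q ^ 2) ^ a • LinearMap.id := LinearMap.ext_on_range h3 fun k => by
    cases k with
    | zero => simpa using hv
    | succ k =>
      rw [pow_succ, Module.End.mul_apply, hE, map_zero, map_zero, map_zero]
  rw [this, LinearMap.smul_apply, LinearMap.id_apply]

/-- Any module `X` commutes with the simple module `T` of weight `q ^ (2 a)`: the map
`x ⊗ t ↦ t ⊗ K ^ (-a) x` is an isomorphism. -/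
theorem IsString.nonempty_iso_tensor_comm (X : FinMod.{u} (UqPlus D)) {T : FinMod.{u} (UqPlus D)}
    {a : ℕ} (hT : T.IsString a 0) : Nonempty (Iso (X.tensor T) (T.tensor X)) := by
  have hq2 := D.q_sq_ne_zero
  have hd : a + (D.d - 1) * a = D.d * a := by
    rw [add_comm, ← Nat.succ_mul, Nat.succ_eq_add_one, Nat.sub_add_cancel D.d_pos]
  have hK1 : X.act (UqPlus.K D) ^ (a + (D.d - 1) * a) = 1 := by
    rw [hd, pow_mul, act_K_pow_d, one_pow]
  have hq1 : (D.q ^ 2) ^ a * (D.q ^ 2) ^ ((D.d - 1) * a) = 1 := by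
    rw [← pow_add, hd, pow_mul, D.sq_prim.pow_eq_one, one_pow]
  -- the action of `K ^ (-a)`, written with the exponent `(d - 1) a`
  let κ : X.carrier ≃ₗ[ℂ] X.carrier :=
    LinearEquiv.ofLinearMap (X.act (UqPlus.K D) ^ ((D.d - 1) * a)) (X.act (UqPlus.K D) ^ a)
      (by rw [← Module.End.mul_eq_comp, ← pow_add, add_comm, hK1]; rfl)
      (by rw [← Module.End.mul_eq_comp, ← pow_add, hK1]; rfl)
  have hκ : ∀ x, κ x = (X.act (UqPlus.K D) ^ ((D.d - 1) * a)) x := fun x => rfl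
  have hκE : ∀ x, κ (X.act (UqPlus.E D) x) =
      (D.q ^ 2) ^ ((D.d - 1) * a) • X.act (UqPlus.E D) (κ x) := fun x => by
    have h := pow_mul_qcomm (UqPlus.K_E D) ((D.d - 1) * a)
    simpa [hκ] using LinearMap.congr_fun (congrArg X.act h) x
  have hκK : ∀ x, κ (X.act (UqPlus.K D) x) = X.act (UqPlus.K D) (κ x) := fun x => by
    rw [hκ, hκ, ← Module.End.mul_apply, ← pow_succ, pow_succ', Module.End.mul_apply]
  let f := (TensorProduct.comm ℂ X.carrier T.carrier).trans
    (TensorProduct.congr (LinearEquiv.refl ℂ T.carrier) κ)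
  have hf : ∀ x t, f (x ⊗ₜ[ℂ] t) = t ⊗ₜ[ℂ] κ x := fun x t => rfl
  refine ⟨Iso.ofGenerators f (TensorProduct.ext' fun x t => ?_)
    (TensorProduct.ext' fun x t => ?_)⟩
  · rw [LinearMap.comp_apply, LinearMap.comp_apply, LinearEquiv.coe_coe, tensor_act_E,
      hT.act_E_of_zero, hT.act_K_of_zero, TensorProduct.tmul_zero, zero_add, hf, hf, hκE,
      tensor_act_E, hT.act_E_of_zero, TensorProduct.zero_tmul, add_zero, TensorProduct.smul_tmul,
      smul_smul, hq1, one_smul]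
  · rw [LinearMap.comp_apply, LinearMap.comp_apply, LinearEquiv.coe_coe, tensor_act_K, hf, hf,
      tensor_act_K, hκK]

/-- The flip of two simple modules. -/
noncomputable def simpleFlipIso {S T : FinMod.{u} (UqPlus D)} {a b : ℕ} (hS : S.IsString a 0)
    (hT : T.IsString b 0) : Iso (S.tensor T) (T.tensor S) :=
  Iso.ofGenerators (TensorProduct.comm ℂ S.carrier T.carrier)
    (TensorProduct.ext' fun s t => by
      rw [LinearMap.comp_apply, LinearMap.comp_apply, LinearEquiv.coe_coe, tensor_act_E,
        TensorProduct.comm_tmul, tensor_act_E, hS.act_E_of_zero, hT.act_E_of_zero]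
      simp)
    (TensorProduct.ext' fun s t => by
      rw [LinearMap.comp_apply, LinearMap.comp_apply, LinearEquiv.coe_coe, tensor_act_K,
        TensorProduct.comm_tmul, TensorProduct.comm_tmul, tensor_act_K])

/-- The required isomorphism is read off from the decompositions `M ≅ S ⊗ X`, `N ≅ T ⊗ Y`: it is
the composite of their rearrangement with (flip of `S`, `T`) `⊗ τ R`. -/
theorem exists_isRMatrixIso {M N : FinMod.{u} (UqPlus D)} {a b u v : ℕ} (hM : M.IsString a u)
    (hN : N.IsString b v) (hu : ∃ j, D.d ∣ 2 * j + u) (hv : ∃ j, D.d ∣ 2 * j + v) :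
    ∃ f : Iso (M.tensor N) (N.tensor M), IsRMatrixIso f := by
  obtain ⟨S, a', X, j, hS, hX, ⟨α⟩⟩ := hM.exists_iso_tensor hu
  obtain ⟨T, b', Y, l, hT, hY, ⟨β⟩⟩ := hN.exists_iso_tensor hv
  obtain ⟨k⟩ := hT.nonempty_iso_tensor_comm X.restrict
  obtain ⟨k'⟩ := hS.nonempty_iso_tensor_comm Y.restrict
  refine ⟨(α.tensor β).trans <| (rearrangeIso S X.restrict T Y.restrict k).trans <|
    ((simpleFlipIso hS hT).tensor (tauRIso X Y)).trans <|
      (rearrangeIso T Y.restrict S X.restrict k').symm.trans (β.tensor α).symm,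
    S, T, X, Y, α, β, k, k', hS.isSimple, hT.isSimple, hX.isIndecomposable, hY.isIndecomposable,
    fun z => ?_⟩
  refine (congrArg (rearrange T Y.restrict S X.restrict k')
    (LinearEquiv.apply_symm_apply (TensorProduct.congr β.equiv α.equiv) _)).trans ?_
  exact LinearEquiv.apply_symm_apply (rearrange T Y.restrict S X.restrict k') _

/-! ### Direct sums of isomorphisms -/

section Blocks

variable {A : Type} [Ring A] [Algebra ℂ A]

/-- The inclusion of a summand of `M ≅ ⨁ P i`. -/
noncomputable def Iso.incl {r : ℕ} {P : Fin r → FinMod.{u} A} {M : FinMod.{u} A}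
    (a : Iso (directSum P) M) (i : Fin r) : (P i).carrier →ₗ[ℂ] M.carrier :=
  a.equiv.toLinearMap ∘ₗ LinearMap.single ℂ (fun i => (P i).carrier) i

/-- The projection to a summand of `M ≅ ⨁ P i`. -/
noncomputable def Iso.proj {r : ℕ} {P : Fin r → FinMod.{u} A} {M : FinMod.{u} A}
    (a : Iso (directSum P) M) (i : Fin r) : M.carrier →ₗ[ℂ] (P i).carrier :=
  LinearMap.proj i ∘ₗ a.equiv.symm.toLinearMap

variable {r : ℕ} {P : Fin r → FinMod.{u} A} {M : FinMod.{u} A} (a : Iso (directSum P) M)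

theorem Iso.proj_comp_incl_self (i : Fin r) : a.proj i ∘ₗ a.incl i = LinearMap.id := by
  refine LinearMap.ext fun x => ?_
  simp [Iso.proj, Iso.incl]

theorem Iso.proj_comp_incl_of_ne {i j : Fin r} (h : j ≠ i) : a.proj j ∘ₗ a.incl i = 0 := by
  refine LinearMap.ext fun x => ?_
  simp [Iso.proj, Iso.incl, h]

theorem Iso.sum_incl_proj (x : M.carrier) : ∑ i, a.incl i (a.proj i x) = x := by
  have h : ∑ i, LinearMap.single ℂ (fun i => (P i).carrier) i (a.equiv.symm x i) =
      a.equiv.symm x := LinearMap.sum_single_apply _ _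
  have h2 := congrArg a.equiv h
  rw [map_sum, LinearEquiv.apply_symm_apply] at h2
  exact h2

theorem Iso.incl_act (i : Fin r) (t : A) (x : (P i).carrier) :
    a.incl i ((P i).act t x) = M.act t (a.incl i x) := by
  refine Eq.trans ?_ (a.map_act t (Pi.single i x))
  refine congrArg a.equiv (funext fun j => ?_)
  change (Pi.single i ((P i).act t x) : ∀ j, (P j).carrier) j =
    (P j).act t ((Pi.single i x : ∀ j, (P j).carrier) j)
  by_cases h : j = i
  · subst h; simp
  · simp [h]

end Blocks

variable {r s : ℕ} {P : Fin r → FinMod.{u} (UqPlus D)} {Q : Fin s → FinMod.{u} (UqPlus D)}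
  {M N : FinMod.{u} (UqPlus D)} (a : Iso (directSum P) M) (b : Iso (directSum Q) N)

/-- A linear map on `M ⊗ N` is determined by its values on the blocks `P i ⊗ Q j`. -/
theorem block_ext {Z : Type*} [AddCommGroup Z] [Module ℂ Z]
    {g h : M.carrier ⊗[ℂ] N.carrier →ₗ[ℂ] Z}
    (H : ∀ i j, g ∘ₗ TensorProduct.map (a.incl i) (b.incl j) =
      h ∘ₗ TensorProduct.map (a.incl i) (b.incl j)) : g = h := by
  refine TensorProduct.ext' fun x y => ?_
  rw [← a.sum_incl_proj x, ← b.sum_incl_proj y]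
  simp only [TensorProduct.sum_tmul, TensorProduct.tmul_sum, map_sum]
  refine Finset.sum_congr rfl fun j _ => Finset.sum_congr rfl fun i _ => ?_
  exact LinearMap.congr_fun (H i j) (a.proj i x ⊗ₜ[ℂ] b.proj j y)

/-- The direct sum of linear maps `P i ⊗ Q j → Q j ⊗ P i`, as a map `M ⊗ N → N ⊗ M`. -/
noncomputable def blockMap
    (c : ∀ i j, (P i).carrier ⊗[ℂ] (Q j).carrier →ₗ[ℂ] (Q j).carrier ⊗[ℂ] (P i).carrier) :
    M.carrier ⊗[ℂ] N.carrier →ₗ[ℂ] N.carrier ⊗[ℂ] M.carrier :=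
  ∑ i, ∑ j, TensorProduct.map (b.incl j) (a.incl i) ∘ₗ c i j ∘ₗ
    TensorProduct.map (a.proj i) (b.proj j)

theorem blockMap_comp_incl
    (c : ∀ i j, (P i).carrier ⊗[ℂ] (Q j).carrier →ₗ[ℂ] (Q j).carrier ⊗[ℂ] (P i).carrier)
    (i : Fin r) (j : Fin s) : blockMap a b c ∘ₗ TensorProduct.map (a.incl i) (b.incl j) =
      TensorProduct.map (b.incl j) (a.incl i) ∘ₗ c i j := by
  have h : ∀ i' j', (TensorProduct.map (b.incl j') (a.incl i') ∘ₗ c i' j' ∘ₗ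
      TensorProduct.map (a.proj i') (b.proj j')) ∘ₗ TensorProduct.map (a.incl i) (b.incl j) =
      TensorProduct.map (b.incl j') (a.incl i') ∘ₗ c i' j' ∘ₗ
        TensorProduct.map (a.proj i' ∘ₗ a.incl i) (b.proj j' ∘ₗ b.incl j) := fun i' j' => by
    rw [TensorProduct.map_comp]; rfl
  refine LinearMap.ext fun z => ?_
  rw [blockMap, LinearMap.comp_apply, LinearMap.sum_apply, Finset.sum_eq_single i,
    LinearMap.sum_apply, Finset.sum_eq_single j]
  · refine (LinearMap.congr_fun (h i j) z).trans ?_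
    rw [a.proj_comp_incl_self, b.proj_comp_incl_self, TensorProduct.map_id, LinearMap.comp_id]
  · intro j' _ hj
    refine (LinearMap.congr_fun (h i j') z).trans ?_
    rw [b.proj_comp_incl_of_ne hj, TensorProduct.map_zero_right, LinearMap.comp_zero,
      LinearMap.comp_zero, LinearMap.zero_apply]
  · simp
  · intro i' _ hi
    rw [LinearMap.sum_apply]
    refine Finset.sum_eq_zero fun j' _ => (LinearMap.congr_fun (h i' j') z).trans ?_
    rw [a.proj_comp_incl_of_ne hi, TensorProduct.map_zero_left, LinearMap.comp_zero,
      LinearMap.comp_zero, LinearMap.zero_apply]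
  · simp

theorem tensor_act_comp_map {M' N' : FinMod.{u} (UqPlus D)} {f : M'.carrier →ₗ[ℂ] M.carrier}
    {g : N'.carrier →ₗ[ℂ] N.carrier} (hf : ∀ t x, f (M'.act t x) = M.act t (f x))
    (hg : ∀ t x, g (N'.act t x) = N.act t (g x)) (t : UqPlus D) :
    (M.tensor N).act t ∘ₗ TensorProduct.map f g =
      TensorProduct.map f g ∘ₗ (M'.tensor N').act t := by
  refine LinearMap.ext fun z => ?_
  rw [LinearMap.comp_apply, LinearMap.comp_apply]
  refine (map_act_of_generators (M := M'.tensor N') (N := M.tensor N) (TensorProduct.map f g)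
    (TensorProduct.ext' fun x y => ?_) (TensorProduct.ext' fun x y => ?_) t z).symm
  · rw [LinearMap.comp_apply, LinearMap.comp_apply, tensor_act_E, map_add, TensorProduct.map_tmul,
      TensorProduct.map_tmul, TensorProduct.map_tmul, tensor_act_E, hf, hg, hg]
  · rw [LinearMap.comp_apply, LinearMap.comp_apply, tensor_act_K, TensorProduct.map_tmul,
      TensorProduct.map_tmul, tensor_act_K, hf, hg]

/-- The direct sum of isomorphisms `P i ⊗ Q j ≅ Q j ⊗ P i`. -/
noncomputable def Iso.block (c : ∀ i j, Iso ((P i).tensor (Q j)) ((Q j).tensor (P i))) :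
    Iso (M.tensor N) (N.tensor M) where
  equiv := LinearEquiv.ofLinearMap (blockMap a b fun i j => (c i j).equiv.toLinearMap)
    (blockMap b a fun j i => (c i j).equiv.symm.toLinearMap)
    (block_ext b a fun j i => by
      rw [LinearMap.comp_assoc, blockMap_comp_incl, ← LinearMap.comp_assoc, blockMap_comp_incl,
        LinearMap.comp_assoc, LinearEquiv.comp_symm]
      rfl)
    (block_ext a b fun i j => by
      rw [LinearMap.comp_assoc, blockMap_comp_incl, ← LinearMap.comp_assoc, blockMap_comp_incl,
        LinearMap.comp_assoc, LinearEquiv.symm_comp]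
      rfl)
  map_act t := by
    refine LinearMap.congr_fun (f := blockMap a b (fun i j => (c i j).equiv.toLinearMap) ∘ₗ
      (M.tensor N).act t) (g := (N.tensor M).act t ∘ₗ
        blockMap a b fun i j => (c i j).equiv.toLinearMap) (block_ext a b fun i j => ?_)
    rw [LinearMap.comp_assoc, tensor_act_comp_map (a.incl_act i) (b.incl_act j),
      ← LinearMap.comp_assoc, blockMap_comp_incl, LinearMap.comp_assoc, LinearMap.comp_assoc,
      blockMap_comp_incl, ← LinearMap.comp_assoc _ _ ((N.tensor M).act t),
      tensor_act_comp_map (b.incl_act j) (a.incl_act i), LinearMap.comp_assoc]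
    congr 1
    exact LinearMap.ext fun z => (c i j).map_act t z

/-! ### The orbit of the extendable indecomposables -/

theorem IsString.inOrbit {M : FinMod.{u} (UqPlus D)} {a u : ℕ} (h : M.IsString a u)
    (hu : ∃ j, D.d ∣ 2 * j + u) : M.InOrbit := by
  obtain ⟨S, b, X, j, hS, hX, α⟩ := h.exists_iso_tensor hu
  exact ⟨S, X.restrict, hS.isSimple, hX.isIndecomposable, ⟨X.act, rfl⟩, α⟩

theorem InOrbit.isIndecomposable {M : FinMod.{u} (UqPlus D)} (h : M.InOrbit) :
    M.IsIndecomposable := by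
  obtain ⟨S, X, hS, hX, -, ⟨α⟩⟩ := h
  obtain ⟨a, ha⟩ := hS.isString
  obtain ⟨b, u, hb⟩ := IsIndecomposable.exists_isString hX
  exact ((ha.tensor hb).of_iso α.symm).isIndecomposable

theorem IsString.even_of_odd_dim {M : FinMod.{u} (UqPlus D)} {a u : ℕ} (h : M.IsString a u)
    (hd : Odd M.dim) : Even u := by
  rw [h.dim, Nat.odd_add_one, Nat.not_odd_iff_even] at hd
  exact hd

theorem IsStandard.isString {M : FinMod.{u} (UqPlus D)} {i : ZMod D.d} {u : ℕ}
    (h : M.IsStandard i u) : M.IsString i.val u := by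
  obtain ⟨e, he⟩ := h
  have hpow : ∀ k, ∀ hk : k < u + 1, (M.act (UqPlus.E D) ^ k) (e 0) = e ⟨k, hk⟩ := by
    intro k
    induction k with
    | zero => intro _; rfl
    | succ k ih =>
      intro hk
      rw [pow_succ', Module.End.mul_apply, ih (by omega), (he _).2, dif_pos hk]
  refine ⟨e 0, ?_, ?_, ?_, ?_⟩
  · rw [(he 0).1, ← pow_mul]; rfl
  · rw [pow_succ', Module.End.mul_apply, hpow u (by omega), (he _).2, dif_neg (by simp)]
  · rw [hpow u (by omega)]
    exact e.ne_zero _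
  · rw [eq_top_iff, ← e.span_eq, Submodule.span_le]
    rintro _ ⟨k, rfl⟩
    exact Submodule.subset_span ⟨k, hpow k k.2⟩

end FinMod

end HalfQuantum

theorem corollary4p1 (D : HalfQuantum.RootDatum) :
    (Odd D.d →
      (∀ M : HalfQuantum.FinMod.{u} (HalfQuantum.UqPlus D), M.InOrbit ↔ M.IsIndecomposable) ∧
      (∀ M N : HalfQuantum.FinMod.{u} (HalfQuantum.UqPlus D),
        M.IsIndecomposable → N.IsIndecomposable →
        ∃ f : HalfQuantum.FinMod.Iso (M.tensor N) (N.tensor M),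
          HalfQuantum.FinMod.IsRMatrixIso f) ∧
      (∀ M N : HalfQuantum.FinMod.{u} (HalfQuantum.UqPlus D),
        ∃ f : HalfQuantum.FinMod.Iso (M.tensor N) (N.tensor M),
          HalfQuantum.FinMod.IsBlockwiseRMatrixIso f)) ∧
    (Even D.d →
      (∀ M : HalfQuantum.FinMod.{u} (HalfQuantum.UqPlus D),
        M.IsIndecomposable → Odd M.dim → M.InOrbit) ∧
      (∀ M N : HalfQuantum.FinMod.{u} (HalfQuantum.UqPlus D),
        M.IsIndecomposable → N.IsIndecomposable → Odd M.dim → Odd N.dim →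
        ∃ f : HalfQuantum.FinMod.Iso (M.tensor N) (N.tensor M),
          HalfQuantum.FinMod.IsRMatrixIso f) ∧
      (∀ (i j : ZMod D.d) (u v : ℕ), u ≤ D.d - 1 → v ≤ D.d - 1 → Even u → Even v →
        ∀ M N : HalfQuantum.FinMod.{u} (HalfQuantum.UqPlus D),
          M.IsStandard i u → N.IsStandard j v →
          ∃ f : HalfQuantum.FinMod.Iso (M.tensor N) (N.tensor M),
            HalfQuantum.FinMod.IsRMatrixIso f)) := by
  refine ⟨fun hd => ?_, fun _ => ⟨?_, ?_, ?_⟩⟩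
  · have hR : ∀ M N : HalfQuantum.FinMod.{u} (HalfQuantum.UqPlus D),
        M.IsIndecomposable → N.IsIndecomposable →
        ∃ f : HalfQuantum.FinMod.Iso (M.tensor N) (N.tensor M),
          HalfQuantum.FinMod.IsRMatrixIso f := fun M N hM hN => by
      obtain ⟨a, u, hs⟩ := hM.exists_isString
      obtain ⟨b, v, ht⟩ := hN.exists_isString
      exact HalfQuantum.FinMod.exists_isRMatrixIso hs ht
        (HalfQuantum.RootDatum.exists_dvd_of_odd hd u)
        (HalfQuantum.RootDatum.exists_dvd_of_odd hd v)
    refine ⟨fun M => ⟨HalfQuantum.FinMod.InOrbit.isIndecomposable, fun hM => ?_⟩, hR, fun M N => ?_⟩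
    · obtain ⟨a, u, hs⟩ := hM.exists_isString
      exact hs.inOrbit (HalfQuantum.RootDatum.exists_dvd_of_odd hd u)
    · obtain ⟨r, P, hP, ⟨a⟩⟩ := HalfQuantum.FinMod.exists_decomposition M
      obtain ⟨s, Q, hQ, ⟨b⟩⟩ := HalfQuantum.FinMod.exists_decomposition N
      choose c hc using fun i j => hR (P i) (Q j) (hP i) (hQ j)
      exact ⟨HalfQuantum.FinMod.Iso.block a b c, r, s, P, Q, a, b, c, hP, hQ, hc, fun i j z =>
        LinearMap.congr_fun (HalfQuantum.FinMod.blockMap_comp_incl a b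
          (fun i j => (c i j).equiv.toLinearMap) i j) z⟩
  · intro M hM hodd
    obtain ⟨a, u, hs⟩ := hM.exists_isString
    exact hs.inOrbit (D.exists_dvd_of_even (hs.even_of_odd_dim hodd))
  · intro M N hM hN hMo hNo
    obtain ⟨a, u, hs⟩ := hM.exists_isString
    obtain ⟨b, v, ht⟩ := hN.exists_isString
    exact HalfQuantum.FinMod.exists_isRMatrixIso hs ht
      (D.exists_dvd_of_even (hs.even_of_odd_dim hMo))
      (D.exists_dvd_of_even (ht.even_of_odd_dim hNo))
  · intro i j u v _ _ hu hv M N hM hN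
    exact HalfQuantum.FinMod.exists_isRMatrixIso hM.isString hN.isString
      (D.exists_dvd_of_even hu) (D.exists_dvd_of_even hv)
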